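/- Theorem 1. Let $b\ge 2$ be an integer. For a sequence $d=(d_1,d_2,\dots)$ in $\{0,\dots,b-1\}$, a real $\lambda>0$ and integers $j,k\ge 0$, let \[ Z^{\lambda}_{j,k}(d)=\frac1{b^k}\,\bigl|\{w\in\{0,\dots,b-1\}^k : w \text{ occurs exactly } j \text{ times (overlaps allowed) in } d_1d_2\cdots d_{\lfloor \lambda b^k+k\rfloor}\}\bigr| . \] A real number $x$ is Poisson generic in base $b$ if its fractional part $x-\lfloor x\rfloor$ has a base-$b$ expansion $\sum_{j\ge1} d_j b^{-j}$ with infinitely many nonzero digits such that $\lim_{k\to\infty} Z^{\lambda}_{j,k}(d)=e^{-\lambda}\lambda^j/j!$ for every real $\lambda>0$ and every integer $j\ge 0$. Let $\mathcal P_b$ be the set of real numbers that are Poisson generic in base $b$. Then $\mathcal P_b$ is $\boldsymbol{\Pi}^0_3$-complete as a subset of $\mathbb R$, and $\mathcal P_b\cap[0,1)$ is $\boldsymbol{\Pi}^0_3$-complete as a subset of the space $[0,1)$. Here, in any topological space, the $\boldsymbol{\Sigma}^0_1$ sets are the open sets, the $\boldsymbol{\Pi}^0_1$ sets are the closed sets,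 the $\boldsymbol{\Sigma}^0_{n+1}$ sets are the countable unions of $\boldsymbol{\Pi}^0_n$ sets, and the $\boldsymbol{\Pi}^0_{n+1}$ sets are the countable intersections of $\boldsymbol{\Sigma}^0_n$ sets. A subset $A$ of a topological space $Y$ is $\boldsymbol{\Pi}^0_3$-complete if it is $\boldsymbol{\Pi}^0_3$ and, for every zero-dimensional Polish space $X$ and every $\boldsymbol{\Pi}^0_3$ set $B\subseteq X$, there is a continuous $f:X\to Y$ with $f^{-1}(A)=B$. -/

import Mathlib

open Filter Topology Set

/-! ### Poisson generic reals -/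

/-- The number of occurrences of the word `w` of length `k` in the initial segment of length `N`
of the sequence `d` (whose entries are indexed from `0`). Occurrences may overlap. -/
def wordOccurrences {b k : ℕ} (d : ℕ → Fin b) (N : ℕ) (w : Fin k → Fin b) : ℕ :=
  ((Finset.range (N + 1)).filter (fun p => p + k ≤ N ∧ ∀ i : Fin k, d (p + i) = w i)).card

/-- The proportion, among all words of length `k` in base `b`, of the words that occur exactly
`j` times in the initial segment of `d` of length `⌊r * b ^ k + k⌋`. -/
noncomputable def poissonZ {b : ℕ} (r : ℝ) (j k : ℕ) (d : ℕ → Fin b) : ℝ :=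
  ((Finset.univ.filter (fun w : Fin k → Fin b =>
      wordOccurrences d ⌊r * (b : ℝ) ^ k + (k : ℝ)⌋₊ w = j)).card : ℝ) / (b : ℝ) ^ k

/-- The digit sequence `d` is Poisson generic: it is `r`-Poisson generic for every real `r > 0`. -/
def IsPoissonGenericSeq {b : ℕ} (d : ℕ → Fin b) : Prop :=
  ∀ r : ℝ, 0 < r → ∀ j : ℕ,
    Tendsto (fun k => poissonZ r j k d) atTop (𝓝 (Real.exp (-r) * r ^ j / (j.factorial : ℝ)))

/-- `d` is a base `b` expansion of `x`, in the form having infinitely many nonzero digits: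
`x = ∑ j, d j / b ^ (j + 1)`. -/
def IsBaseExpansion {b : ℕ} (x : ℝ) (d : ℕ → Fin b) : Prop :=
  Real.ofDigits d = x ∧ ∃ᶠ j in atTop, (d j : ℕ) ≠ 0

/-- The set of real numbers that are Poisson generic in base `b`. The integer part of the number
is disregarded. (The expansion is unique when it exists; it exists unless `x` is an integer, and
integers are not Poisson generic.) -/
def poissonGenericReals (b : ℕ) : Set ℝ :=
  {x | ∃ d : ℕ → Fin b, IsBaseExpansion (Int.fract x) d ∧ IsPoissonGenericSeq d}

/-! ### The finite levels of the boldface Borel hierarchy -/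

mutual

/-- Boldface `Σ⁰ₙ` subsets of a topological space, meaningful for `n ≥ 1`
(level `0` is a convention and is set to be the clopen sets). -/
def IsBoldSigma {X : Type*} [TopologicalSpace X] : ℕ → Set X → Prop
  | 0, s => IsClopen s
  | 1, s => IsOpen s
  | n + 2, s => ∃ A : ℕ → Set X, (∀ i, IsBoldPi (n + 1) (A i)) ∧ s = ⋃ i, A i

/-- Boldface `Π⁰ₙ` subsets of a topological space, meaningful for `n ≥ 1`
(level `0` is a convention and is set to be the clopen sets). -/
def IsBoldPi {X : Type*} [TopologicalSpace X] : ℕ → Set X → Prop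
  | 0, s => IsClopen s
  | 1, s => IsClosed s
  | n + 2, s => ∃ A : ℕ → Set X, (∀ i, IsBoldSigma (n + 1) (A i)) ∧ s = ⋂ i, A i

end

/-- `A ⊆ Y` is `Π⁰ₙ`-hard: every `Π⁰ₙ` subset of every zero-dimensional Polish space is the
preimage of `A` under a continuous map. (Every Polish space is homeomorphic to one in `Type`.) -/
def IsBoldPiHard {Y : Type*} [TopologicalSpace Y] (n : ℕ) (A : Set Y) : Prop :=
  ∀ (X : Type) [TopologicalSpace X] [PolishSpace X],
    TopologicalSpace.IsTopologicalBasis {U : Set X | IsClopen U} →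
    ∀ B : Set X, IsBoldPi n B → ∃ f : X → Y, Continuous f ∧ ∀ x, x ∈ B ↔ f x ∈ A

/-- `A ⊆ Y` is `Π⁰ₙ`-complete: it is `Π⁰ₙ` and `Π⁰ₙ`-hard. -/
def IsBoldPiComplete {Y : Type*} [TopologicalSpace Y] (n : ℕ) (A : Set Y) : Prop :=
  IsBoldPi n A ∧ IsBoldPiHard n A

-- Upper bound. For fixed `k` the frequency `poissonZ` depends on finitely many digits, and as a
-- function of the parameter it is Lipschitz up to an error `1 / b ^ k`, so rational parameters
-- suffice. Genericity of a digit sequence then reads "for all `(q, j, N)` there is `K`" followed by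
-- a closed condition. The space of digit sequences is compact, so closed conditions have closed
-- images in the reals. Ambiguous expansions occur only at numbers `z / b ^ n`; none of these is
-- generic, and deleting this countable set costs only countably many `Σ⁰₂` conditions
-- (`poissonGenericReals_eq`).
--
-- Hardness. In a zero-dimensional Polish space every `Π⁰₃` set has the form `{x | z m x → ∞}` with
-- each `z m` continuous (`IsBoldPi.exists_tendsto_atTop_iff`). Fix a generic sequence `e` and
-- overwrite by ones the last `b ^ m / (z m + 2)` digits before position `b ^ m`, for every `m`. If
-- `z → ∞`, only `o(b ^ k)` windows change at scale `k`, and all limits survive. If `z` stays below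
-- some `c` infinitely often, then at those scales a fixed proportion of the text is constant and
-- contributes almost no new words, whereas the Poisson law requires the proportion of unseen words
-- to drop from `exp (-r)` to `exp (-s)`. Hence `ofDigits_spoiledSeq_mem_iff`.
--
-- Existence of `e`. Take independent uniform digits. The mean of `poissonZ` is within `O(k / b ^
-- k)` of the Poisson mass by the Chen–Stein method (`stein_sum_le`), and its variance is `O(k ^ 2 /
-- b ^ k)` by bounded differences (`exists_mean_sum_sq_sub_le`). These errors are summable in `k`,
-- which gives almost sure convergence (`exists_isPoissonGenericSeq`).

-- Counting windows by starting position, and stability of the frequencies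

/-- The word of length `k` that occurs in `d` at position `p`. -/
def digitWindow {b : ℕ} (k : ℕ) (d : ℕ → Fin b) (p : ℕ) : Fin k → Fin b := fun i => d (p + i)

/-- The number of positions `p < n` at which the word `w` occurs in `d`. -/
def windowCount {b k : ℕ} (n : ℕ) (d : ℕ → Fin b) (w : Fin k → Fin b) : ℕ :=
  ((Finset.range n).filter (fun p => digitWindow k d p = w)).card

/-- The proportion of words of length `k` that occur in `d` at exactly `j` positions `p < n`. -/
noncomputable def windowFreq {b : ℕ} (n j k : ℕ) (d : ℕ → Fin b) : ℝ :=
  ((Finset.univ.filter (fun w : Fin k → Fin b => windowCount n d w = j)).card : ℝ) / (b : ℝ) ^ k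

theorem wordOccurrences_add_eq_windowCount {b k : ℕ} (n : ℕ) (d : ℕ → Fin b) (w : Fin k → Fin b) :
    wordOccurrences d (n + k) w = windowCount (n + 1) d w := by
  unfold wordOccurrences windowCount
  congr 1
  ext p
  simp only [Finset.mem_filter, Finset.mem_range, digitWindow, funext_iff]
  constructor
  · rintro ⟨_, h, h'⟩
    exact ⟨by omega, h'⟩
  · rintro ⟨h, h'⟩
    exact ⟨by omega, by omega, h'⟩

/-- The summand `k` in the text length is exactly what a last window needs, so the admissible
starting positions are `0, …, ⌊r * b ^ k⌋`; hence the `+ 1`. -/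
theorem poissonZ_eq_windowFreq {b : ℕ} {r : ℝ} (hr : 0 ≤ r) (j k : ℕ) (d : ℕ → Fin b) :
    poissonZ r j k d = windowFreq (⌊r * (b : ℝ) ^ k⌋₊ + 1) j k d := by
  unfold poissonZ windowFreq
  rw [Nat.floor_add_natCast (by positivity)]
  simp only [wordOccurrences_add_eq_windowCount]

theorem abs_card_filter_sub_le {α : Type*} [DecidableEq α] (s S : Finset α) (P Q : α → Prop)
    [DecidablePred P] [DecidablePred Q] (h : ∀ w, w ∉ S → (P w ↔ Q w)) :
    |((s.filter P).card : ℝ) - (s.filter Q).card| ≤ S.card := by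
  have key : ∀ (P Q : α → Prop) [DecidablePred P] [DecidablePred Q],
      (∀ w, w ∉ S → (P w ↔ Q w)) → (s.filter P).card ≤ (s.filter Q).card + S.card := by
    intro P Q _ _ h
    refine le_trans (Finset.card_le_card (t := s.filter Q ∪ S) ?_) (Finset.card_union_le _ _)
    intro w hw
    simp only [Finset.mem_filter, Finset.mem_union] at hw ⊢
    by_cases hS : w ∈ S
    · exact Or.inr hS
    · exact Or.inl ⟨hw.1, (h w hS).1 hw.2⟩
  have h1 := key P Q h
  have h2 := key Q P (fun w hw => (h w hw).symm)
  rw [abs_le]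
  constructor
  · have : ((s.filter Q).card : ℝ) ≤ (s.filter P).card + S.card := by exact_mod_cast h2
    linarith
  · have : ((s.filter P).card : ℝ) ≤ (s.filter Q).card + S.card := by exact_mod_cast h1
    linarith

/-- A word can change its count only if one of the two sequences shows it at a position where the
windows differ, and each such position involves two words. This serves both the bounded differences
estimate and the comparison of a spoiled sequence with the original. -/
theorem abs_windowFreq_sub_le_of_seq {b : ℕ} (n j k : ℕ) (d d' : ℕ → Fin b) :
    |windowFreq n j k d - windowFreq n j k d'| ≤
      2 * ((Finset.range n).filter (fun p => digitWindow k d p ≠ digitWindow k d' p)).card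
        / (b : ℝ) ^ k := by
  unfold windowFreq
  rw [← sub_div, abs_div, abs_of_nonneg (a := (b : ℝ) ^ k) (by positivity)]
  gcongr
  set D := (Finset.range n).filter (fun p => digitWindow k d p ≠ digitWindow k d' p)
  refine (abs_card_filter_sub_le _ (D.image (digitWindow k d) ∪ D.image (digitWindow k d'))
    _ _ ?_).trans ?_
  · intro w hw
    have : windowCount n d w = windowCount n d' w := by
      unfold windowCount
      congr 1
      refine Finset.filter_congr fun p hp => ?_
      by_cases hpD : p ∈ D
      · simp only [Finset.mem_union, Finset.mem_image, not_or, not_exists, not_and] at hw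
        simp [hw.1 p hpD, hw.2 p hpD]
      · have : digitWindow k d p = digitWindow k d' p := by
          by_contra hne
          exact hpD (Finset.mem_filter.2 ⟨hp, hne⟩)
        rw [this]
    rw [this]
  · have h1 := Finset.card_union_le (D.image (digitWindow k d)) (D.image (digitWindow k d'))
    have h2 := Finset.card_image_le (s := D) (f := digitWindow k d)
    have h3 := Finset.card_image_le (s := D) (f := digitWindow k d')
    have : (D.image (digitWindow k d) ∪ D.image (digitWindow k d')).card ≤ 2 * D.card := by omega
    exact_mod_cast this

/-- Only words seen at the additional positions change their count. The bound counts distinct words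
rather than positions, which is what makes it strong on constant stretches. -/
theorem abs_windowFreq_sub_le_of_length {b : ℕ} {n n' : ℕ} (hn : n ≤ n') (j k : ℕ)
    (d : ℕ → Fin b) :
    |windowFreq n j k d - windowFreq n' j k d| ≤
      ((Finset.Ico n n').image (digitWindow k d)).card / (b : ℝ) ^ k := by
  unfold windowFreq
  rw [← sub_div, abs_div, abs_of_nonneg (a := (b : ℝ) ^ k) (by positivity)]
  gcongr
  refine abs_card_filter_sub_le _ _ _ _ fun w hw => ?_
  have : windowCount n d w = windowCount n' d w := by
    unfold windowCount
    congr 1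
    ext p
    simp only [Finset.mem_image, Finset.mem_Ico, not_exists, not_and] at hw
    simp only [Finset.mem_filter, Finset.mem_range]
    constructor
    · rintro ⟨h, h'⟩
      exact ⟨by omega, h'⟩
    · rintro ⟨h, h'⟩
      refine ⟨?_, h'⟩
      by_contra hlt
      exact hw p ⟨by omega, h⟩ h'
  rw [this]

theorem abs_poissonZ_sub_le {b : ℕ} (hb : 0 < b) {r s : ℝ} (hr : 0 ≤ r) (hrs : r ≤ s) (j k : ℕ)
    (d : ℕ → Fin b) :
    |poissonZ r j k d - poissonZ s j k d| ≤ (s - r) + 1 / (b : ℝ) ^ k := by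
  have hbk : 0 < (b : ℝ) ^ k := by positivity
  rw [poissonZ_eq_windowFreq hr, poissonZ_eq_windowFreq (hr.trans hrs)]
  have hfl : ⌊r * (b : ℝ) ^ k⌋₊ ≤ ⌊s * (b : ℝ) ^ k⌋₊ := by gcongr
  refine (abs_windowFreq_sub_le_of_length (by omega) j k d).trans ?_
  rw [div_le_iff₀ hbk, add_mul, div_mul_cancel₀ _ hbk.ne']
  have h1 : (((Finset.Ico (⌊r * (b : ℝ) ^ k⌋₊ + 1) (⌊s * (b : ℝ) ^ k⌋₊ + 1)).image
      (digitWindow k d)).card : ℝ) ≤ ((⌊s * (b : ℝ) ^ k⌋₊ - ⌊r * (b : ℝ) ^ k⌋₊ : ℕ) : ℝ) := by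
    have := Finset.card_image_le (s := Finset.Ico (⌊r * (b : ℝ) ^ k⌋₊ + 1)
      (⌊s * (b : ℝ) ^ k⌋₊ + 1)) (f := digitWindow k d)
    rw [Nat.card_Ico, Nat.add_sub_add_right] at this
    exact Nat.cast_le.2 this
  rw [Nat.cast_sub hfl] at h1
  have h2 := Nat.floor_le (a := s * (b : ℝ) ^ k) (by have := hr.trans hrs; positivity)
  have h3 := Nat.lt_floor_add_one (r * (b : ℝ) ^ k)
  linarith

-- Rational parameters suffice; long constant stretches exclude genericity

/-- The mass of the Poisson law of parameter `r` at `j`. -/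
noncomputable def poissonMass (r : ℝ) (j : ℕ) : ℝ := Real.exp (-r) * r ^ j / (j.factorial : ℝ)

theorem continuous_poissonMass (j : ℕ) : Continuous (fun r => poissonMass r j) := by
  unfold poissonMass
  fun_prop

theorem tendsto_one_div_pow_natCast {b : ℕ} (hb : 2 ≤ b) :
    Tendsto (fun k => 1 / (b : ℝ) ^ k) atTop (𝓝 0) := by
  have : (1 : ℝ) < b := by exact_mod_cast hb
  simpa [one_div, Function.comp_def] using tendsto_inv_atTop_zero.comp (tendsto_pow_atTop_atTop_of_one_lt this)

/-- Poisson genericity needs to be checked for rational parameters only. -/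
theorem isPoissonGenericSeq_of_rat {b : ℕ} (hb : 2 ≤ b) {d : ℕ → Fin b}
    (h : ∀ q : ℚ, 0 < q → ∀ j : ℕ,
      Tendsto (fun k => poissonZ (q : ℝ) j k d) atTop (𝓝 (poissonMass q j))) :
    IsPoissonGenericSeq d := by
  intro r hr j
  change Tendsto _ _ (𝓝 (poissonMass r j))
  rw [Metric.tendsto_atTop]
  intro ε hε
  obtain ⟨δ, hδ, hcont⟩ := Metric.continuous_iff.1 (continuous_poissonMass j) r (ε / 4) (by linarith)
  -- Four errors of size `ε / 4`: the shift of the parameter from `r` to `q`, the rounding `1 / b ^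
  -- k`, the convergence at `q`, and the continuity of the Poisson mass.
  obtain ⟨q, hq1, hq2⟩ := exists_rat_btwn (show r < r + min δ (ε / 4) by
    have : 0 < min δ (ε / 4) := lt_min hδ (by linarith)
    linarith)
  have hqr : (q : ℝ) - r < δ := by have := min_le_left δ (ε / 4); linarith
  have hqr' : (q : ℝ) - r < ε / 4 := by have := min_le_right δ (ε / 4); linarith
  have hq0 : 0 < q := by
    have : (0 : ℝ) < q := hr.trans hq1
    exact_mod_cast this
  obtain ⟨N₁, hN₁⟩ := Metric.tendsto_atTop.1 (h q hq0 j) (ε / 4) (by linarith)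
  obtain ⟨N₂, hN₂⟩ := Metric.tendsto_atTop.1 (tendsto_one_div_pow_natCast hb) (ε / 4) (by linarith)
  refine ⟨max N₁ N₂, fun k hk => ?_⟩
  have h1 := hN₁ k (le_of_max_le_left hk)
  have h2 := hN₂ k (le_of_max_le_right hk)
  have h3 := abs_poissonZ_sub_le (b := b) (by omega) hr.le hq1.le j k d
  have h4 := hcont q (by rw [Real.dist_eq, abs_of_pos (by linarith)]; exact hqr)
  rw [Real.dist_eq] at h1 h2 h4 ⊢
  rw [sub_zero] at h2
  have h5 := (abs_lt.1 h2).2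
  rw [abs_lt] at h1 h4 ⊢
  rw [abs_le] at h3
  constructor <;> linarith [h1.1, h1.2, h3.1, h3.2, h4.1, h4.2]

/-- A sequence which, for infinitely many `k`, is constant between positions `r * b ^ k` and
`s * b ^ k` is not Poisson generic. -/
theorem not_isPoissonGenericSeq_of_frequently_const {b : ℕ} (hb : 2 ≤ b) {d : ℕ → Fin b}
    {r s : ℝ} (hr : 0 < r) (hrs : r < s) (a : Fin b)
    (h : ∃ᶠ k : ℕ in atTop,
      ∀ x, ⌊r * (b : ℝ) ^ k⌋₊ < x → x < ⌊s * (b : ℝ) ^ k⌋₊ → d x = a) :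
    ¬ IsPoissonGenericSeq d := by
  intro hd
  have h1 := hd r hr 0
  have h2 := hd s (hr.trans hrs) 0
  simp only [pow_zero, mul_one, Nat.factorial_zero, Nat.cast_one, div_one] at h1 h2
  have hexp : 0 < Real.exp (-r) - Real.exp (-s) := by
    have := Real.exp_lt_exp.2 (neg_lt_neg hrs)
    linarith
  have h3 : Tendsto (fun k : ℕ => ((k : ℝ) + 2) / (b : ℝ) ^ k) atTop (𝓝 0) := by
    have hb1 : (1 : ℝ) < b := by exact_mod_cast hb
    have e1 := tendsto_pow_const_div_const_pow_of_one_lt 1 hb1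
    have e2 := (tendsto_one_div_pow_natCast hb).const_mul 2
    have := e1.add e2
    simp only [pow_one, mul_zero, add_zero] at this
    refine this.congr fun k => ?_
    ring
  have h4 := (h1.sub h2).sub h3
  rw [sub_zero] at h4
  have h5 : ∀ᶠ k in atTop, 0 < poissonZ r 0 k d - poissonZ s 0 k d - ((k : ℝ) + 2) / (b : ℝ) ^ k :=
    h4.eventually (lt_mem_nhds hexp)
  obtain ⟨k, hk, hk'⟩ := (h.and_eventually h5).exists
  have hbk : 0 < (b : ℝ) ^ k := by positivity
  rw [poissonZ_eq_windowFreq hr.le, poissonZ_eq_windowFreq (hr.trans hrs).le] at hk'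
  set A := ⌊r * (b : ℝ) ^ k⌋₊
  set B := ⌊s * (b : ℝ) ^ k⌋₊
  have hAB : A ≤ B := by unfold A B; gcongr
  have h6 := abs_windowFreq_sub_le_of_length (show A + 1 ≤ B + 1 by omega) 0 k d
  -- The windows inside the stretch all show the constant word; at most `k + 1` further windows
  -- reach past its end.
  have h7 : ((Finset.Ico (A + 1) (B + 1)).image (digitWindow k d)).card ≤ k + 2 := by
    have : (Finset.Ico (A + 1) (B + 1)).image (digitWindow k d) ⊆
        insert (fun _ => a) ((Finset.Ioc (B - k - 1) B).image (digitWindow k d)) := by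
      intro w hw
      simp only [Finset.mem_image, Finset.mem_Ico, Finset.mem_insert, Finset.mem_Ioc] at hw ⊢
      obtain ⟨p, hp, rfl⟩ := hw
      by_cases hpk : p + k ≤ B
      · left
        funext i
        exact hk _ (by omega) (by omega)
      · right
        exact ⟨p, by omega, rfl⟩
    refine (Finset.card_le_card this).trans ((Finset.card_insert_le _ _).trans ?_)
    have := Finset.card_image_le (s := Finset.Ioc (B - k - 1) B) (f := digitWindow k d)
    rw [Nat.card_Ioc] at this
    omega
  have h8 : (((Finset.Ico (A + 1) (B + 1)).image (digitWindow k d)).card : ℝ) / (b : ℝ) ^ k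
      ≤ ((k : ℝ) + 2) / (b : ℝ) ^ k := by
    gcongr
    exact_mod_cast h7
  have h9 := (abs_le.1 (h6.trans h8)).2
  linarith

theorem not_isPoissonGenericSeq_of_eventually_const {b : ℕ} (hb : 2 ≤ b) {d : ℕ → Fin b}
    (a : Fin b) (h : ∀ᶠ x in atTop, d x = a) : ¬ IsPoissonGenericSeq d := by
  refine not_isPoissonGenericSeq_of_frequently_const hb one_pos one_lt_two a
    (Eventually.frequently ?_)
  obtain ⟨N, hN⟩ := eventually_atTop.1 h
  filter_upwards [eventually_ge_atTop N] with k hk x hx _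
  refine hN x ?_
  have : ⌊1 * (b : ℝ) ^ k⌋₊ = b ^ k := by
    rw [one_mul]; exact_mod_cast Nat.floor_natCast (R := ℝ) (b ^ k)
  rw [this] at hx
  have := Nat.lt_pow_self (n := k) (show 1 < b by omega)
  omega

-- The Stein equation of the Poisson law

/-- Compare the tail termwise with the full series, using `n! * m! ≤ (n + m)!`. -/
theorem exp_sub_sum_le {r : ℝ} (hr : 0 ≤ r) (n : ℕ) :
    Real.exp r - ∑ l ∈ Finset.range n, r ^ l / (l.factorial : ℝ) ≤
      r ^ n / (n.factorial : ℝ) * Real.exp r := by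
  have hs : Summable (fun l : ℕ => r ^ l / (l.factorial : ℝ)) := Real.summable_pow_div_factorial r
  have he : Real.exp r = ∑' l : ℕ, r ^ l / (l.factorial : ℝ) := by
    rw [Real.exp_eq_exp_ℝ, NormedSpace.exp_eq_tsum_div]
  have h1 := hs.sum_add_tsum_nat_add n
  rw [he, ← h1, add_sub_cancel_left, h1, ← tsum_mul_left]
  refine Summable.tsum_le_tsum (fun m => ?_) ((summable_nat_add_iff n).2 hs) (hs.mul_left _)
  rw [div_mul_div_comm, ← pow_add, add_comm n m]
  gcongr
  have := Nat.le_of_dvd (Nat.factorial_pos _) (Nat.factorial_mul_factorial_dvd_factorial_add n m)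
  rw [add_comm n m] at this
  exact_mod_cast this

/-- The Poisson law satisfies a Stein equation with bounded solutions. -/
theorem exists_bounded_stein_solution {r : ℝ} (hr : 0 < r) (j : ℕ) :
    ∃ (g : ℕ → ℝ) (C : ℝ), 0 ≤ C ∧ (∀ i, |g i| ≤ C) ∧
      ∀ i : ℕ, r * g (i + 1) - i * g i = (if i = j then 1 else 0) - poissonMass r j := by
  set p := poissonMass r j with hp
  have hp0 : 0 ≤ p := by unfold p poissonMass; positivity
  -- Multiplying the Stein equation by `r ^ i / i!` makes it telescope, so its solution is a
  -- rescaled partial sum `S`. The full series of these terms vanishes; past `j` the partial sum is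
  -- therefore `p` times a tail of the exponential series, and this keeps `g` bounded.
  set S : ℕ → ℝ := fun i => ∑ l ∈ Finset.range i,
    r ^ l / (l.factorial : ℝ) * ((if l = j then 1 else 0) - p) with hS
  have hS1 : ∀ i, j < i →
      S i = p * (Real.exp r - ∑ l ∈ Finset.range i, r ^ l / (l.factorial : ℝ)) := by
    intro i hi
    have : p * Real.exp r = r ^ j / (j.factorial : ℝ) := by
      have h0 : Real.exp (-r) * Real.exp r = 1 := by rw [← Real.exp_add]; simp
      rw [hp, poissonMass]
      linear_combination (r ^ j / (j.factorial : ℝ)) * h0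
    rw [mul_sub, this, hS]
    simp only [mul_sub, Finset.sum_sub_distrib, mul_ite, mul_one, mul_zero, Finset.sum_ite_eq',
      Finset.mem_range, hi, if_true, mul_comm p, Finset.sum_mul]
  -- At `i = 0` the truncated `i - 1` is harmless, since `S 0 = 0`.
  set g : ℕ → ℝ := fun i => ((i - 1).factorial : ℝ) / r ^ i * S i with hg
  have hbound : ∀ i, j < i → |g i| ≤ p * Real.exp r := by
    intro i hi
    have h1 := exp_sub_sum_le hr.le i
    have h2 : 0 ≤ Real.exp r - ∑ l ∈ Finset.range i, r ^ l / (l.factorial : ℝ) :=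
      sub_nonneg.2 (Real.sum_le_exp_of_nonneg hr.le i)
    have hfac : ((i - 1).factorial : ℝ) ≤ i.factorial := by
      exact_mod_cast Nat.factorial_le (Nat.sub_le i 1)
    rw [hg]
    simp only
    rw [hS1 i hi, abs_of_nonneg (by positivity)]
    calc ((i - 1).factorial : ℝ) / r ^ i *
          (p * (Real.exp r - ∑ l ∈ Finset.range i, r ^ l / (l.factorial : ℝ)))
        ≤ (i.factorial : ℝ) / r ^ i * (p * (r ^ i / (i.factorial : ℝ) * Real.exp r)) := by
          gcongr
      _ = p * Real.exp r := by field_simp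
  refine ⟨g, p * Real.exp r + ∑ i ∈ Finset.range (j + 1), |g i|, by positivity, ?_, ?_⟩
  · intro i
    have hsum : 0 ≤ ∑ i ∈ Finset.range (j + 1), |g i| := by positivity
    by_cases hi : j < i
    · linarith [hbound i hi]
    · have := Finset.single_le_sum (f := fun i => |g i|) (fun _ _ => abs_nonneg _)
        (Finset.mem_range.2 (show i < j + 1 by omega))
      have h3 : 0 ≤ p * Real.exp r := by positivity
      linarith
  · intro i
    have hSs : S (i + 1) = S i + r ^ i / (i.factorial : ℝ) * ((if i = j then 1 else 0) - p) := by
      rw [hS]; simp only [Finset.sum_range_succ]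
    rw [hg]
    simp only [Nat.add_sub_cancel]
    rw [hSs]
    rcases i with _ | m
    · have : S 0 = 0 := by simp [hS]
      rw [this]
      simp
      field_simp
    · have : ((m + 1).factorial : ℝ) = (m + 1) * m.factorial := by
        push_cast [Nat.factorial_succ]; ring
      rw [this]
      simp only [Nat.add_sub_cancel]
      push_cast
      field_simp
      ring

-- Finite texts: independence and coincidence of windows

/-- The sequence that starts with the word `u` and continues with zeros. -/
def extendByZero {b M : ℕ} [NeZero b] (u : Fin M → Fin b) : ℕ → Fin b :=
  fun x => if h : x < M then u ⟨x, h⟩ else 0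

theorem extendByZero_of_lt {b M : ℕ} [NeZero b] (u : Fin M → Fin b) {x : ℕ} (h : x < M) :
    extendByZero u x = u ⟨x, h⟩ := dif_pos h

theorem digitWindow_congr {b k : ℕ} {d d' : ℕ → Fin b} {p : ℕ}
    (h : ∀ x, p ≤ x → x < p + k → d x = d' x) : digitWindow k d p = digitWindow k d' p := by
  funext i
  exact h _ (by omega) (by omega)

/-- The word obtained from `u` by writing `v` at position `p`. -/
def overwrite {b M k : ℕ} (u : Fin M → Fin b) (p : ℕ) (v : Fin k → Fin b) : Fin M → Fin b :=
  fun x => if h : p ≤ x ∧ (x : ℕ) < p + k then v ⟨x - p, by omega⟩ else u x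

theorem overwrite_of_notMem {b M k : ℕ} (u : Fin M → Fin b) {p : ℕ} (v : Fin k → Fin b)
    {x : Fin M} (h : ¬ (p ≤ x ∧ (x : ℕ) < p + k)) : overwrite u p v x = u x := dif_neg h

theorem digitWindow_overwrite_self {b M k : ℕ} [NeZero b] (u : Fin M → Fin b) {p : ℕ}
    (hp : p + k ≤ M) (v : Fin k → Fin b) :
    digitWindow k (extendByZero (overwrite u p v)) p = v := by
  funext i
  unfold digitWindow
  rw [extendByZero_of_lt _ (show p + (i : ℕ) < M by omega)]
  unfold overwrite
  rw [dif_pos (by simp)]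
  congr 1
  ext
  simp

theorem digitWindow_overwrite_of_far {b M k : ℕ} [NeZero b] (u : Fin M → Fin b) {p q : ℕ}
    (h : p + k ≤ q ∨ q + k ≤ p) (v : Fin k → Fin b) :
    digitWindow k (extendByZero (overwrite u p v)) q = digitWindow k (extendByZero u) q := by
  refine digitWindow_congr fun x hx hx' => ?_
  unfold extendByZero
  split_ifs with hM
  · exact overwrite_of_notMem _ _ (by simp only; omega)
  · rfl

theorem overwrite_overwrite {b M k : ℕ} (u : Fin M → Fin b) (p : ℕ) (v w : Fin k → Fin b) :
    overwrite (overwrite u p v) p w = overwrite u p w := by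
  funext x
  unfold overwrite
  split_ifs <;> rfl

theorem overwrite_digitWindow {b M k : ℕ} [NeZero b] (u : Fin M → Fin b) (p : ℕ) :
    overwrite u p (digitWindow k (extendByZero u) p) = u := by
  funext x
  unfold overwrite digitWindow
  split_ifs with h
  · have : p + (x - p) = (x : ℕ) := by omega
    simp only [this]
    rw [extendByZero_of_lt u x.2]
  · rfl

/-- The window at `p` is uniform and independent of any `h` that ignores it: overwriting the window
is a bijection between the fibres over any two words, and it preserves `h`. -/
theorem sum_window_eq_mul_pow {b M k : ℕ} [NeZero b] {p : ℕ} (hp : p + k ≤ M)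
    (w : Fin k → Fin b) (h : (Fin M → Fin b) → ℝ) (hh : ∀ u v, h (overwrite (k := k) u p v) = h u) :
    (∑ u with digitWindow k (extendByZero u) p = w, h u) * (b : ℝ) ^ k = ∑ u, h u := by
  have h1 := Finset.sum_fiberwise (s := (Finset.univ : Finset (Fin M → Fin b)))
    (fun u => digitWindow k (extendByZero u) p) h
  rw [← h1]
  have h2 : ∀ v : Fin k → Fin b, ∑ u with digitWindow k (extendByZero u) p = v, h u =
      ∑ u with digitWindow k (extendByZero u) p = w, h u := by
    intro v
    refine Finset.sum_nbij' (fun u => overwrite u p w) (fun u => overwrite u p v) ?_ ?_ ?_ ?_ ?_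
    · intro u _
      simp [digitWindow_overwrite_self u hp]
    · intro u _
      simp [digitWindow_overwrite_self u hp]
    · intro u hu
      simp only [Finset.mem_filter, Finset.mem_univ, true_and] at hu
      rw [overwrite_overwrite, ← hu, overwrite_digitWindow]
    · intro u hu
      simp only [Finset.mem_filter, Finset.mem_univ, true_and] at hu
      rw [overwrite_overwrite, ← hu, overwrite_digitWindow]
    · intro u _
      exact (hh u w).symm
  rw [Finset.sum_congr rfl (fun v _ => h2 v)]
  simp [mul_comm]

/-- Two windows agree with probability at most `b ^ (-k)`, even if they overlap. Writing an
arbitrary word over the later window loses no information: when the two windows agreed, the erased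
digits are recovered from left to right, each being a copy of the digit `q - p` places before it. -/
theorem card_window_eq_window_mul_le {b M k : ℕ} [NeZero b] {p q : ℕ} (hpq : p ≠ q)
    (hp : p + k ≤ M) (hq : q + k ≤ M) :
    (Finset.univ.filter (fun u : Fin M → Fin b =>
      digitWindow k (extendByZero u) p = digitWindow k (extendByZero u) q)).card * b ^ k
      ≤ b ^ M := by
  wlog h : p < q generalizing p q
  · have := this hpq.symm hq hp (by omega)
    simpa only [eq_comm] using this
  set A := Finset.univ.filter (fun u : Fin M → Fin b =>
      digitWindow k (extendByZero u) p = digitWindow k (extendByZero u) q)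
  have hcard : (A ×ˢ (Finset.univ : Finset (Fin k → Fin b))).card = A.card * b ^ k := by
    simp [Finset.card_product]
  have hcard' : (Finset.univ : Finset (Fin M → Fin b)).card = b ^ M := by simp
  rw [← hcard, ← hcard']
  refine Finset.card_le_card_of_injOn (fun x => overwrite x.1 q x.2) (by simp) ?_
  rintro ⟨u, v⟩ hu ⟨u', v'⟩ hu' heq
  simp only [Finset.coe_product, Finset.coe_univ, Set.mem_prod, Finset.mem_coe, Set.mem_univ,
    and_true] at hu hu' heq
  have hv : v = v' := by
    rw [← digitWindow_overwrite_self u hq v, heq, digitWindow_overwrite_self u' hq v']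
  have hval : ∀ u ∈ A, ∀ x, q ≤ x → x < q + k →
      extendByZero u x = extendByZero u (p + (x - q)) := by
    intro u hu x hx hx'
    have h1 := congrFun (Finset.mem_filter.1 hu).2 ⟨x - q, by omega⟩
    simp only [digitWindow] at h1
    rw [h1]
    congr 1
    omega
  have huu : ∀ x, ∀ hx : x < M, u ⟨x, hx⟩ = u' ⟨x, hx⟩ := by
    intro x
    induction x using Nat.strong_induction_on with
    | _ x ih =>
      intro hx
      by_cases hxq : q ≤ x ∧ x < q + k
      · have h1 := hval u hu x hxq.1 hxq.2
        have h2 := hval u' hu' x hxq.1 hxq.2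
        rw [extendByZero_of_lt _ hx, extendByZero_of_lt _ (by omega)] at h1 h2
        rw [h1, h2]
        exact ih _ (by omega) _
      · have := congrFun heq ⟨x, hx⟩
        rwa [overwrite_of_notMem _ _ hxq, overwrite_of_notMem _ _ hxq] at this
  have : u = u' := funext fun x => huu x x.2
  rw [this, hv]

-- The Chen–Stein estimate for word counts

section Stein

variable {b k n M : ℕ}

theorem sum_card_eq_sum_fiber (A : Finset ℕ) (d : ℕ → Fin b) :
    ∑ w : Fin k → Fin b, (A.filter (fun q => digitWindow k d q = w)).card = A.card :=
  (Finset.card_eq_sum_card_fiberwise (f := digitWindow k d) (t := Finset.univ) (by simp)).symm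

theorem abs_sub_le_of_eq_add {g : ℕ → ℝ} {C : ℝ} (hg : ∀ i, |g i| ≤ C) {x y m : ℕ}
    (h : x = y + m) : |g x - g y| ≤ 2 * C * m := by
  rcases m with _ | m
  · simp [h]
  · have hC : 0 ≤ C := (abs_nonneg _).trans (hg 0)
    have h1 := abs_le.1 (hg x)
    have h2 := abs_le.1 (hg y)
    have h3 : (1 : ℝ) ≤ ((m + 1 : ℕ) : ℝ) := by
      push_cast
      have : (0 : ℝ) ≤ m := by positivity
      linarith
    have h4 : |g x - g y| ≤ 2 * C := by rw [abs_le]; constructor <;> linarith [h1.1, h1.2, h2.1, h2.2]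
    nlinarith

theorem card_near_le (p n k : ℕ) :
    ((Finset.range n).filter (fun q => q ≠ p ∧ q < p + k ∧ p < q + k)).card ≤ 2 * k := by
  have : (Finset.range n).filter (fun q => q ≠ p ∧ q < p + k ∧ p < q + k) ⊆
      Finset.Ico (p - k) p ∪ Finset.Ico p (p + k) := by
    intro q hq
    simp only [Finset.mem_filter, Finset.mem_range, Finset.mem_union, Finset.mem_Ico] at hq ⊢
    omega
  refine (Finset.card_le_card this).trans ((Finset.card_union_le _ _).trans ?_)
  simp only [Nat.card_Ico]
  omega

/-- The number of positions `q < n` at distance at least `k` from `p` where `w` occurs. -/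
def farWindowCount (n : ℕ) (d : ℕ → Fin b) (p : ℕ) (w : Fin k → Fin b) : ℕ :=
  (((Finset.range n).filter (fun q => p + k ≤ q ∨ q + k ≤ p)).filter
    (fun q => digitWindow k d q = w)).card

/-- The number of positions `q < n`, other than `p` and at distance less than `k` from `p`,
where `w` occurs. -/
def nearWindowCount (n : ℕ) (d : ℕ → Fin b) (p : ℕ) (w : Fin k → Fin b) : ℕ :=
  (((Finset.range n).filter (fun q => q ≠ p ∧ q < p + k ∧ p < q + k)).filter
    (fun q => digitWindow k d q = w)).card

/-- The condition `0 < k` keeps `p` out of its own far positions, so that it is counted once. -/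
theorem windowCount_eq_add (hk : 0 < k) (d : ℕ → Fin b) {p : ℕ} (hp : p < n) (w : Fin k → Fin b) :
    windowCount n d w =
      farWindowCount n d p w + nearWindowCount n d p w + if digitWindow k d p = w then 1 else 0 := by
  unfold windowCount farWindowCount nearWindowCount
  simp only [Finset.card_filter, Finset.sum_filter]
  have hs : (if digitWindow k d p = w then 1 else 0) = ∑ q ∈ Finset.range n,
      if q = p then (if digitWindow k d q = w then 1 else 0) else 0 := by
    rw [Finset.sum_ite_eq', if_pos (Finset.mem_range.2 hp)]
  rw [hs, ← Finset.sum_add_distrib, ← Finset.sum_add_distrib]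
  refine Finset.sum_congr rfl fun q _ => ?_
  by_cases h1 : q = p
  · have h2 : ¬ (p + k ≤ q ∨ q + k ≤ p) := by omega
    simp [h1, hk.ne']
  · by_cases h2 : p + k ≤ q ∨ q + k ≤ p
    · have h3 : ¬ (q ≠ p ∧ q < p + k ∧ p < q + k) := by omega
      rw [if_pos h2, if_neg h3, if_neg h1, add_zero, add_zero]
    · have h3 : q ≠ p ∧ q < p + k ∧ p < q + k := by omega
      rw [if_neg h2, if_pos h3, if_neg h1]
      simp

variable [NeZero b] {g : ℕ → ℝ} {C : ℝ}

/-- The two arguments of `g` differ by the number of near repetitions of the word at `p`. There are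
at most `2 * k` near positions, and each repeats that word with probability at most `b ^ (-k)`. -/
theorem sum_self_window_sub_far_le (hk : 0 < k) (hC : 0 ≤ C) (hg : ∀ i, |g i| ≤ C) {p : ℕ}
    (hp : p < n) (hM : n + k ≤ M) :
    |∑ u : Fin M → Fin b,
        (g (windowCount n (extendByZero u) (digitWindow k (extendByZero u) p)) -
          g (farWindowCount n (extendByZero u) p (digitWindow k (extendByZero u) p) + 1))| *
      (b : ℝ) ^ k ≤ 4 * C * k * (b : ℝ) ^ M := by
  set near := (Finset.range n).filter (fun q => q ≠ p ∧ q < p + k ∧ p < q + k) with hnear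
  have h1 : |∑ u : Fin M → Fin b,
        (g (windowCount n (extendByZero u) (digitWindow k (extendByZero u) p)) -
          g (farWindowCount n (extendByZero u) p (digitWindow k (extendByZero u) p) + 1))| ≤
      ∑ u : Fin M → Fin b, 2 * C *
        (nearWindowCount n (extendByZero u) p (digitWindow k (extendByZero u) p) : ℝ) := by
    refine (Finset.abs_sum_le_sum_abs _ _).trans (Finset.sum_le_sum fun u _ => ?_)
    refine abs_sub_le_of_eq_add hg ?_
    rw [windowCount_eq_add hk _ hp, if_pos rfl]
    omega
  have h2 : ∑ u : Fin M → Fin b,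
        nearWindowCount n (extendByZero u) p (digitWindow k (extendByZero u) p) =
      ∑ q ∈ near, (Finset.univ.filter (fun u : Fin M → Fin b =>
        digitWindow k (extendByZero u) q = digitWindow k (extendByZero u) p)).card := by
    simp only [nearWindowCount, Finset.card_filter]
    exact Finset.sum_comm
  have h3 : (∑ q ∈ near, (Finset.univ.filter (fun u : Fin M → Fin b =>
        digitWindow k (extendByZero u) q = digitWindow k (extendByZero u) p)).card) * b ^ k ≤
      2 * k * b ^ M := by
    rw [Finset.sum_mul]
    calc _ ≤ ∑ q ∈ near, b ^ M := by
            refine Finset.sum_le_sum fun q hq => ?_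
            simp only [hnear, Finset.mem_filter, Finset.mem_range] at hq
            exact card_window_eq_window_mul_le hq.2.1 (by omega) (by omega)
      _ = near.card * b ^ M := by simp
      _ ≤ 2 * k * b ^ M := Nat.mul_le_mul_right _ (card_near_le p n k)
  rw [← h2] at h3
  have h4 : (∑ u : Fin M → Fin b,
      (nearWindowCount n (extendByZero u) p (digitWindow k (extendByZero u) p) : ℝ)) * (b : ℝ) ^ k
      ≤ 2 * k * (b : ℝ) ^ M := by exact_mod_cast h3
  rw [← Finset.mul_sum] at h1
  calc _ ≤ (2 * C * ∑ u : Fin M → Fin b,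
      (nearWindowCount n (extendByZero u) p (digitWindow k (extendByZero u) p) : ℝ)) *
        (b : ℝ) ^ k := by gcongr
    _ = 2 * C * ((∑ u : Fin M → Fin b,
      (nearWindowCount n (extendByZero u) p (digitWindow k (extendByZero u) p) : ℝ)) *
        (b : ℝ) ^ k) := by ring
    _ ≤ 2 * C * (2 * k * (b : ℝ) ^ M) := by gcongr
    _ = _ := by ring

/-- The far count of a fixed word does not read the window at `p`, so the word at `p` may be
replaced by an independent uniform one. -/
theorem sum_far_self_window {p : ℕ} (hp : p < n) (hM : n + k ≤ M) (g : ℕ → ℝ) :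
    (∑ u : Fin M → Fin b,
        g (farWindowCount n (extendByZero u) p (digitWindow k (extendByZero u) p) + 1)) *
      (b : ℝ) ^ k =
    ∑ u : Fin M → Fin b, ∑ w : Fin k → Fin b, g (farWindowCount n (extendByZero u) p w + 1) := by
  rw [Finset.sum_comm, ← Finset.sum_fiberwise (s := (Finset.univ : Finset (Fin M → Fin b)))
    (fun u => digitWindow k (extendByZero u) p), Finset.sum_mul]
  refine Finset.sum_congr rfl fun w _ => ?_
  rw [← sum_window_eq_mul_pow (b := b) (k := k) (p := p) (M := M) (by omega) w
    (fun u => g (farWindowCount n (extendByZero u) p w + 1))]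
  · congr 1
    refine Finset.sum_congr rfl fun u hu => ?_
    rw [(Finset.mem_filter.1 hu).2]
  · intro u v
    have : farWindowCount n (extendByZero (overwrite u p v)) p w =
        farWindowCount n (extendByZero u) p w := by
      unfold farWindowCount
      congr 1
      refine Finset.filter_congr fun q hq => ?_
      rw [digitWindow_overwrite_of_far u (Finset.mem_filter.1 hq).2 v]
    rw [this]

/-- For each text, the occurrences omitted by the far counts, summed over all words, are the windows
at `p` and at near positions: at most `2 * k + 1`. -/
theorem sum_far_sub_windowCount_le (hk : 0 < k) (hC : 0 ≤ C) (hg : ∀ i, |g i| ≤ C) {p : ℕ}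
    (hp : p < n) :
    |∑ u : Fin M → Fin b, ∑ w : Fin k → Fin b, (g (windowCount n (extendByZero u) w + 1) -
      g (farWindowCount n (extendByZero u) p w + 1))| ≤ 2 * C * (2 * k + 1) * (b : ℝ) ^ M := by
  have h1 : ∀ u : Fin M → Fin b, |∑ w : Fin k → Fin b, (g (windowCount n (extendByZero u) w + 1) -
      g (farWindowCount n (extendByZero u) p w + 1))| ≤ 2 * C * (2 * k + 1) := by
    intro u
    have h2 : ∑ w : Fin k → Fin b, (nearWindowCount n (extendByZero u) p w +
        if digitWindow k (extendByZero u) p = w then 1 else 0) ≤ 2 * k + 1 := by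
      rw [Finset.sum_add_distrib]
      unfold nearWindowCount
      rw [sum_card_eq_sum_fiber]
      have := card_near_le p n k
      simp only [Finset.sum_ite_eq, Finset.mem_univ, if_true]
      omega
    have h3 : (∑ w : Fin k → Fin b, ((nearWindowCount n (extendByZero u) p w +
        if digitWindow k (extendByZero u) p = w then 1 else 0 : ℕ) : ℝ)) ≤ 2 * k + 1 := by
      exact_mod_cast h2
    calc _ ≤ ∑ w : Fin k → Fin b, |g (windowCount n (extendByZero u) w + 1) -
          g (farWindowCount n (extendByZero u) p w + 1)| := Finset.abs_sum_le_sum_abs _ _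
      _ ≤ ∑ w : Fin k → Fin b, 2 * C * ((nearWindowCount n (extendByZero u) p w +
        if digitWindow k (extendByZero u) p = w then 1 else 0 : ℕ) : ℝ) := by
          refine Finset.sum_le_sum fun w _ => abs_sub_le_of_eq_add hg ?_
          rw [windowCount_eq_add hk _ hp]
          omega
      _ ≤ _ := by
          rw [← Finset.mul_sum]
          gcongr
  calc _ ≤ ∑ u : Fin M → Fin b, |∑ w : Fin k → Fin b, (g (windowCount n (extendByZero u) w + 1) -
      g (farWindowCount n (extendByZero u) p w + 1))| := Finset.abs_sum_le_sum_abs _ _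
    _ ≤ ∑ u : Fin M → Fin b, 2 * C * (2 * k + 1) := Finset.sum_le_sum fun u _ => h1 u
    _ = _ := by
      simp
      ring

theorem sum_self_window_sub_le (hk : 0 < k) (hC : 0 ≤ C) (hg : ∀ i, |g i| ≤ C) {p : ℕ}
    (hp : p < n) (hM : n + k ≤ M) :
    |(∑ u : Fin M → Fin b,
        g (windowCount n (extendByZero u) (digitWindow k (extendByZero u) p))) * (b : ℝ) ^ k -
      ∑ u : Fin M → Fin b, ∑ w : Fin k → Fin b, g (windowCount n (extendByZero u) w + 1)| ≤
      2 * C * (4 * k + 1) * (b : ℝ) ^ M := by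
  have h1 := sum_self_window_sub_far_le (b := b) hk hC hg hp hM
  have h2 := sum_far_self_window (b := b) hp hM g
  have h3 := sum_far_sub_windowCount_le (b := b) (M := M) hk hC hg hp
  have hbk : (0 : ℝ) ≤ (b : ℝ) ^ k := by positivity
  rw [Finset.sum_sub_distrib, ← abs_of_nonneg hbk, ← abs_mul, sub_mul, h2] at h1
  simp only [Finset.sum_sub_distrib] at h3
  rw [abs_le] at h1 h3 ⊢
  constructor <;> linarith [h1.1, h1.2, h3.1, h3.2]

/-- The Chen–Stein estimate, for the average over all texts `u` and all words `w`. -/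
theorem stein_sum_le (hk : 0 < k) (hC : 0 ≤ C) (hg : ∀ i, |g i| ≤ C) (hM : n + k ≤ M) (r : ℝ) :
    |∑ u : Fin M → Fin b, ∑ w : Fin k → Fin b,
      (r * g (windowCount n (extendByZero u) w + 1) -
        windowCount n (extendByZero u) w * g (windowCount n (extendByZero u) w))| * (b : ℝ) ^ k ≤
      (|r * (b : ℝ) ^ k - n| * C * (b : ℝ) ^ k + n * (2 * C * (4 * k + 1))) * (b : ℝ) ^ M := by
  set G := ∑ u : Fin M → Fin b, ∑ w : Fin k → Fin b, g (windowCount n (extendByZero u) w + 1)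
    with hG
  have hGle : |G| ≤ C * (b : ℝ) ^ k * (b : ℝ) ^ M := by
    calc |G| ≤ ∑ u : Fin M → Fin b, ∑ w : Fin k → Fin b, C := by
          refine (Finset.abs_sum_le_sum_abs _ _).trans (Finset.sum_le_sum fun u _ => ?_)
          exact (Finset.abs_sum_le_sum_abs _ _).trans (Finset.sum_le_sum fun w _ => hg _)
      _ = _ := by
          simp
          ring
  -- Size biasing: weighting a word by its count amounts to picking a position and reading the word
  -- there.
  have h1 : ∑ u : Fin M → Fin b, ∑ w : Fin k → Fin b,
      (windowCount n (extendByZero u) w : ℝ) * g (windowCount n (extendByZero u) w) =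
      ∑ p ∈ Finset.range n, ∑ u : Fin M → Fin b,
        g (windowCount n (extendByZero u) (digitWindow k (extendByZero u) p)) := by
    rw [Finset.sum_comm (s := Finset.range n)]
    refine Finset.sum_congr rfl fun u _ => ?_
    rw [← Finset.sum_fiberwise (s := Finset.range n) (digitWindow k (extendByZero u))]
    refine Finset.sum_congr rfl fun w _ => ?_
    rw [Finset.sum_congr rfl (g := fun _ => g (windowCount n (extendByZero u) w))
      (fun p hp => by rw [(Finset.mem_filter.1 hp).2])]
    rw [Finset.sum_const, nsmul_eq_mul]
    rfl
  have h2 : |(∑ p ∈ Finset.range n, ∑ u : Fin M → Fin b,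
        g (windowCount n (extendByZero u) (digitWindow k (extendByZero u) p))) * (b : ℝ) ^ k
        - n * G| ≤ n * (2 * C * (4 * k + 1) * (b : ℝ) ^ M) := by
    have : (n : ℝ) * G = ∑ p ∈ Finset.range n, G := by simp
    rw [this, Finset.sum_mul, ← Finset.sum_sub_distrib]
    calc _ ≤ ∑ p ∈ Finset.range n, 2 * C * (4 * k + 1) * (b : ℝ) ^ M := by
          refine (Finset.abs_sum_le_sum_abs _ _).trans (Finset.sum_le_sum fun p hp => ?_)
          exact sum_self_window_sub_le hk hC hg (Finset.mem_range.1 hp) hM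
      _ = _ := by simp
  simp only [Finset.sum_sub_distrib, ← Finset.mul_sum]
  rw [h1, ← hG]
  set H := ∑ p ∈ Finset.range n, ∑ u : Fin M → Fin b,
        g (windowCount n (extendByZero u) (digitWindow k (extendByZero u) p))
  have hbk : (0 : ℝ) ≤ (b : ℝ) ^ k := by positivity
  calc |r * G - H| * (b : ℝ) ^ k = |(r * (b : ℝ) ^ k - n) * G - (H * (b : ℝ) ^ k - n * G)| := by
        rw [← abs_of_nonneg hbk, ← abs_mul, abs_of_nonneg hbk]
        congr 1
        ring
    _ ≤ |(r * (b : ℝ) ^ k - n) * G| + |H * (b : ℝ) ^ k - n * G| := abs_sub _ _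
    _ ≤ |r * (b : ℝ) ^ k - n| * (C * (b : ℝ) ^ k * (b : ℝ) ^ M) +
        n * (2 * C * (4 * k + 1) * (b : ℝ) ^ M) := by
        rw [abs_mul]
        gcongr
    _ = _ := by ring

end Stein

/-- The average of `poissonZ r j k` over all texts differs from the Poisson mass by
`O(k / b ^ k)`. -/
theorem exists_abs_sum_windowFreq_sub_le {b : ℕ} [NeZero b] {r : ℝ} (hr : 0 < r) (j : ℕ) :
    ∃ K : ℝ, 0 ≤ K ∧ ∀ k M : ℕ, 0 < k → ⌊r * (b : ℝ) ^ k⌋₊ + 1 + k ≤ M →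
      |∑ u : Fin M → Fin b,
        (windowFreq (⌊r * (b : ℝ) ^ k⌋₊ + 1) j k (extendByZero u) - poissonMass r j)| ≤
      K * k / (b : ℝ) ^ k * (b : ℝ) ^ M := by
  obtain ⟨g, C, hC, hg, hst⟩ := exists_bounded_stein_solution hr j
  -- The first `C` pays for `|r * b ^ k - n| ≤ 1`; the rest comes from `n ≤ (r + 1) * b ^ k` and `2
  -- * C * (4 * k + 1) ≤ 10 * C * k`.
  refine ⟨C + (r + 1) * (10 * C), by positivity, fun k M hk hM => ?_⟩
  set n := ⌊r * (b : ℝ) ^ k⌋₊ + 1 with hn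
  have hb1 : (1 : ℝ) ≤ b := by exact_mod_cast NeZero.one_le
  have hbk : (1 : ℝ) ≤ (b : ℝ) ^ k := one_le_pow₀ hb1
  have hbk0 : (0 : ℝ) < (b : ℝ) ^ k := by positivity
  have h1 := stein_sum_le (b := b) hk hC hg hM r
  have h2 : ∀ u : Fin M → Fin b, ∑ w : Fin k → Fin b,
      (r * g (windowCount n (extendByZero u) w + 1) -
        windowCount n (extendByZero u) w * g (windowCount n (extendByZero u) w)) =
      (windowFreq n j k (extendByZero u) - poissonMass r j) * (b : ℝ) ^ k := by
    intro u
    simp only [hst]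
    unfold windowFreq
    rw [sub_mul, div_mul_cancel₀ _ hbk0.ne', Finset.sum_sub_distrib, Finset.card_filter]
    push_cast
    simp [mul_comm]
  simp only [h2] at h1
  rw [← Finset.sum_mul, abs_mul, abs_of_pos hbk0] at h1
  have hfl1 := Nat.floor_le (a := r * (b : ℝ) ^ k) (by positivity)
  have hfl2 := Nat.lt_floor_add_one (r * (b : ℝ) ^ k)
  have hncast : (n : ℝ) = (⌊r * (b : ℝ) ^ k⌋₊ : ℝ) + 1 := by rw [hn]; push_cast; rfl
  have h3 : |r * (b : ℝ) ^ k - n| ≤ 1 := by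
    rw [abs_le, hncast]
    constructor <;> linarith
  have h4 : (n : ℝ) ≤ (r + 1) * (b : ℝ) ^ k := by
    rw [hncast]
    linarith
  have hk1 : (1 : ℝ) ≤ k := by exact_mod_cast hk
  set T := |∑ u : Fin M → Fin b, (windowFreq n j k (extendByZero u) - poissonMass r j)|
  have h5 : T * (b : ℝ) ^ k * (b : ℝ) ^ k ≤
      ((C + (r + 1) * (10 * C)) * k * (b : ℝ) ^ M) * (b : ℝ) ^ k := by
    refine h1.trans ?_
    calc (|r * (b : ℝ) ^ k - n| * C * (b : ℝ) ^ k + n * (2 * C * (4 * k + 1))) * (b : ℝ) ^ M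
        ≤ (1 * C * (b : ℝ) ^ k + ((r + 1) * (b : ℝ) ^ k) * (2 * C * (4 * k + k))) *
          (b : ℝ) ^ M := by gcongr
      _ = (C * 1 + (r + 1) * (10 * C) * k) * (b : ℝ) ^ M * (b : ℝ) ^ k := by ring
      _ ≤ (C * k + (r + 1) * (10 * C) * k) * (b : ℝ) ^ M * (b : ℝ) ^ k := by gcongr
      _ = _ := by ring
  have h6 := le_of_mul_le_mul_right h5 hbk0
  rw [div_mul_eq_mul_div, le_div_iff₀ hbk0]
  exact h6

-- Variance by bounded differences

/-- A bounded differences (Efron–Stein) inequality for functions on a finite product. -/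
theorem exists_mean_sum_sq_sub_le {α : Type*} [Fintype α] [Nonempty α] {c : ℝ} :
    ∀ (M : ℕ) (f : (Fin M → α) → ℝ), (∀ u i a, |f (Function.update u i a) - f u| ≤ c) →
      ∃ m : ℝ, ∑ u, f u = m * (Fintype.card α : ℝ) ^ M ∧
        ∑ u, (f u - m) ^ 2 ≤ M * c ^ 2 * (Fintype.card α : ℝ) ^ M := by
  have hA : (0 : ℝ) < Fintype.card α := by exact_mod_cast Fintype.card_pos
  intro M
  induction M with
  | zero =>
    intro f _
    refine ⟨f default, ?_, ?_⟩ <;> simp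
  | succ M ih =>
    intro f hf
    have hsum : ∀ F : (Fin (M + 1) → α) → ℝ, ∑ u, F u = ∑ a, ∑ v : Fin M → α, F (Fin.cons a v) := by
      intro F
      rw [← Fintype.sum_prod_type', ← (Fin.consEquiv (fun _ => α)).sum_comp]
      rfl
    have hsec : ∀ a : α, ∃ m : ℝ, ∑ v : Fin M → α, f (Fin.cons a v) = m * (Fintype.card α : ℝ) ^ M ∧
        ∑ v : Fin M → α, (f (Fin.cons a v) - m) ^ 2 ≤ M * c ^ 2 * (Fintype.card α : ℝ) ^ M := by
      intro a
      refine ih (fun v => f (Fin.cons a v)) fun u i x => ?_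
      rw [Fin.cons_update]
      exact hf _ _ _
    -- Here `g a` is the conditional mean given the first coordinate. Conditional means differ
    -- pairwise by at most `c`, hence differ from the overall mean by at most `c`.
    choose g hg1 hg2 using hsec
    have hB : (0 : ℝ) < (Fintype.card α : ℝ) ^ M := by positivity
    have hgg : ∀ a a', |g a - g a'| ≤ c := by
      intro a a'
      have h1 : |g a - g a'| * (Fintype.card α : ℝ) ^ M ≤ c * (Fintype.card α : ℝ) ^ M := by
        rw [← abs_of_pos hB, ← abs_mul, abs_of_pos hB, sub_mul, ← hg1, ← hg1,
          ← Finset.sum_sub_distrib]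
        calc _ ≤ ∑ v : Fin M → α, c := by
              refine (Finset.abs_sum_le_sum_abs _ _).trans (Finset.sum_le_sum fun v _ => ?_)
              have := hf (Fin.cons a' v) 0 a
              rwa [Fin.update_cons_zero] at this
          _ = _ := by simp [mul_comm]
      exact le_of_mul_le_mul_right h1 hB
    set m := (∑ a, g a) / Fintype.card α with hm
    have hmA : m * Fintype.card α = ∑ a, g a := div_mul_cancel₀ _ hA.ne'
    have hgm : ∀ a, |g a - m| ≤ c := by
      intro a
      have h1 : |g a - m| * Fintype.card α ≤ c * Fintype.card α := by
        rw [← abs_of_pos hA, ← abs_mul, abs_of_pos hA, sub_mul, hmA]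
        have : g a * Fintype.card α = ∑ _a' : α, g a := by simp [mul_comm]
        rw [this, ← Finset.sum_sub_distrib]
        calc _ ≤ ∑ _a' : α, c := by
              refine (Finset.abs_sum_le_sum_abs _ _).trans (Finset.sum_le_sum fun v _ => hgg _ _)
          _ = _ := by simp [mul_comm]
      exact le_of_mul_le_mul_right h1 hA
    refine ⟨m, ?_, ?_⟩
    · rw [hsum]
      simp only [hg1]
      rw [← Finset.sum_mul, ← hmA]
      ring
    · rw [hsum]
      have h1 : ∀ a, ∑ v : Fin M → α, (f (Fin.cons a v) - m) ^ 2 ≤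
          (M + 1) * c ^ 2 * (Fintype.card α : ℝ) ^ M := by
        intro a
        -- Pythagoras: the cross term vanishes because `g a` is the mean of the section.
        have h2 : ∑ v : Fin M → α, (f (Fin.cons a v) - m) ^ 2 =
            ∑ v : Fin M → α, (f (Fin.cons a v) - g a) ^ 2 +
              (g a - m) ^ 2 * (Fintype.card α : ℝ) ^ M := by
          have h3 : ∀ v : Fin M → α, (f (Fin.cons a v) - m) ^ 2 =
              (f (Fin.cons a v) - g a) ^ 2 + 2 * (g a - m) * f (Fin.cons a v) +
                ((g a - m) ^ 2 - 2 * (g a - m) * g a) := fun v => by ring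
          simp only [h3, Finset.sum_add_distrib, ← Finset.mul_sum, hg1]
          simp
          ring
        have h4 : (g a - m) ^ 2 ≤ c ^ 2 := sq_le_sq' (abs_le.1 (hgm a)).1 (abs_le.1 (hgm a)).2
        have h5 := mul_le_mul_of_nonneg_right h4 hB.le
        linarith [hg2 a]
      calc _ ≤ ∑ _a : α, (M + 1) * c ^ 2 * (Fintype.card α : ℝ) ^ M :=
            Finset.sum_le_sum fun a _ => h1 a
        _ = _ := by
          simp
          ring

/-- A digit lies in at most `k` windows, and each changed window affects two words. -/
theorem abs_windowFreq_update_sub_le {b M n j k : ℕ} [NeZero b] (u : Fin M → Fin b) (i : Fin M)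
    (a : Fin b) :
    |windowFreq n j k (extendByZero (Function.update u i a)) - windowFreq n j k (extendByZero u)| ≤
      2 * k / (b : ℝ) ^ k := by
  refine (abs_windowFreq_sub_le_of_seq _ _ _ _ _).trans ?_
  gcongr
  refine (Finset.card_le_card (t := Finset.Ico (i + 1 - k) (i + 1 : ℕ)) ?_).trans ?_
  · intro p hp
    rw [Finset.mem_filter] at hp
    by_contra hpi
    refine hp.2 (digitWindow_congr fun x hx hx' => ?_)
    unfold extendByZero
    split_ifs with hM
    · rw [Function.update_of_ne]
      rintro rfl
      simp only [Finset.mem_Ico, not_and, not_lt] at hpi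
      omega
    · rfl
  · rw [Nat.card_Ico]
    omega

/-- The mean square deviation of `poissonZ r j k` from the Poisson mass is `O(k ^ 2 / b ^ k)`. -/
theorem exists_sum_sq_windowFreq_sub_le {b : ℕ} (hb : 2 ≤ b) [NeZero b] {r : ℝ} (hr : 0 < r)
    (j : ℕ) :
    ∃ K : ℝ, 0 ≤ K ∧ ∀ k : ℕ, 0 < k →
      ∑ u : Fin (⌊r * (b : ℝ) ^ k⌋₊ + 1 + k) → Fin b,
        (windowFreq (⌊r * (b : ℝ) ^ k⌋₊ + 1) j k (extendByZero u) - poissonMass r j) ^ 2 ≤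
      K * (k ^ 2 / (b : ℝ) ^ k) * (b : ℝ) ^ (⌊r * (b : ℝ) ^ k⌋₊ + 1 + k) := by
  obtain ⟨K, hK, hmean⟩ := exists_abs_sum_windowFreq_sub_le (b := b) hr j
  -- Variance plus squared bias: `n + k ≤ (r + 1) * b ^ k` digits, each of influence `2 * k / b ^
  -- k`, and a bias of at most `K * k / b ^ k`.
  refine ⟨4 * (r + 1) + K ^ 2, by positivity, fun k hk => ?_⟩
  set n := ⌊r * (b : ℝ) ^ k⌋₊ + 1 with hn
  have h1 := hmean k (n + k) hk le_rfl
  rw [← hn] at h1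
  set p := poissonMass r j
  obtain ⟨m, hm1, hm2⟩ := exists_mean_sum_sq_sub_le (n + k)
    (fun u : Fin (n + k) → Fin b => windowFreq n j k (extendByZero u))
    (fun u i a => abs_windowFreq_update_sub_le u i a)
  rw [Fintype.card_fin] at hm1 hm2
  have hb0 : (0 : ℝ) < b := by positivity
  have hbk0 : (0 : ℝ) < (b : ℝ) ^ k := by positivity
  have hbk1 : (1 : ℝ) ≤ (b : ℝ) ^ k := one_le_pow₀ (by exact_mod_cast (by omega : 1 ≤ b))
  have hB : (0 : ℝ) < (b : ℝ) ^ (n + k) := by positivity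
  rw [Finset.sum_sub_distrib, hm1] at h1
  have h2 : |m - p| ≤ K * k / (b : ℝ) ^ k := by
    refine le_of_mul_le_mul_right (le_trans (le_of_eq ?_) h1) hB
    rw [← abs_of_pos hB, ← abs_mul, abs_of_pos hB, sub_mul]
    congr 1
    simp [mul_comm]
  have h3 : ∑ u : Fin (n + k) → Fin b, (windowFreq n j k (extendByZero u) - p) ^ 2 =
      ∑ u : Fin (n + k) → Fin b, (windowFreq n j k (extendByZero u) - m) ^ 2 +
        (m - p) ^ 2 * (b : ℝ) ^ (n + k) := by
    have h4 : ∀ u : Fin (n + k) → Fin b, (windowFreq n j k (extendByZero u) - p) ^ 2 =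
        (windowFreq n j k (extendByZero u) - m) ^ 2 +
          2 * (m - p) * windowFreq n j k (extendByZero u) + ((m - p) ^ 2 - 2 * (m - p) * m) :=
      fun u => by ring
    simp only [h4, Finset.sum_add_distrib, ← Finset.mul_sum, hm1]
    simp only [Finset.sum_const, Finset.card_univ, Fintype.card_pi, Fintype.card_fin,
      Finset.prod_const, nsmul_eq_mul, Nat.cast_pow]
    ring
  have h5 : (m - p) ^ 2 ≤ K ^ 2 * (k ^ 2 / (b : ℝ) ^ k) := by
    calc (m - p) ^ 2 ≤ (K * k / (b : ℝ) ^ k) ^ 2 := sq_le_sq' (abs_le.1 h2).1 (abs_le.1 h2).2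
      _ = K ^ 2 * (k ^ 2 / ((b : ℝ) ^ k * (b : ℝ) ^ k)) := by ring
      _ ≤ K ^ 2 * (k ^ 2 / ((b : ℝ) ^ k * 1)) := by gcongr
      _ = _ := by rw [mul_one]
  have h6 : (((n + k : ℕ) : ℝ)) ≤ (r + 1) * (b : ℝ) ^ k := by
    have hfl := Nat.floor_le (a := r * (b : ℝ) ^ k) (by positivity)
    have hkb : ((k + 1 : ℕ) : ℝ) ≤ (b : ℝ) ^ k := by
      exact_mod_cast Nat.lt_pow_self (n := k) (show 1 < b by omega)
    rw [hn]
    push_cast at hkb ⊢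
    linarith
  have h7 : ((n + k : ℕ) : ℝ) * (2 * k / (b : ℝ) ^ k) ^ 2 ≤ 4 * (r + 1) * (k ^ 2 / (b : ℝ) ^ k) := by
    calc _ ≤ (r + 1) * (b : ℝ) ^ k * (2 * k / (b : ℝ) ^ k) ^ 2 := by gcongr
      _ = _ := by field_simp; ring
  rw [h3]
  have h8 := mul_le_mul_of_nonneg_right h5 hB.le
  have h9 := mul_le_mul_of_nonneg_right h7 hB.le
  linarith

-- Almost every digit sequence is Poisson generic

section Measure

open MeasureTheory

/-- The law of a sequence of independent uniform digits. -/
noncomputable def uniformDigits (b : ℕ) [NeZero b] : Measure (ℕ → Fin b) :=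
  Measure.infinitePi (fun _ : ℕ => (PMF.uniformOfFintype (Fin b)).toMeasure)

instance (b : ℕ) [NeZero b] : IsProbabilityMeasure (uniformDigits b) := by
  unfold uniformDigits
  infer_instance

/-- The first `M` digits of a sequence. -/
def initialWord {b : ℕ} (M : ℕ) (d : ℕ → Fin b) : Fin M → Fin b := fun i => d i

theorem measurable_initialWord {b : ℕ} (M : ℕ) : Measurable (initialWord (b := b) M) :=
  measurable_pi_lambda _ fun i => measurable_pi_apply (i : ℕ)

theorem uniformDigits_map_initialWord_singleton {b : ℕ} [NeZero b] {M : ℕ} (u : Fin M → Fin b) :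
    (uniformDigits b).map (initialWord M) {u} = ENNReal.ofReal (((b : ℝ) ^ M)⁻¹) := by
  rw [Measure.map_apply (measurable_initialWord M) (measurableSet_singleton u)]
  have : initialWord M ⁻¹' {u} = Set.pi (Finset.range M) (fun i => {extendByZero u i}) := by
    ext d
    simp only [Set.mem_preimage, Set.mem_singleton_iff, Set.mem_pi, Finset.coe_range, Set.mem_Iio,
      funext_iff, initialWord]
    constructor
    · intro h i hi
      rw [extendByZero_of_lt u hi]
      exact h ⟨i, hi⟩
    · intro h i
      rw [h i i.2, extendByZero_of_lt u i.2]
  rw [this, uniformDigits, Measure.infinitePi_pi _ (fun i _ => measurableSet_singleton _)]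
  simp only [PMF.toMeasure_apply_singleton _ _ (measurableSet_singleton _),
    PMF.uniformOfFintype_apply, Fintype.card_fin, Finset.prod_const, Finset.card_range]
  have hb : (0 : ℝ) < b := by
    have := NeZero.pos b
    positivity
  rw [← inv_pow, ENNReal.ofReal_pow (by positivity), ENNReal.ofReal_inv_of_pos hb,
    ENNReal.ofReal_natCast]

theorem windowFreq_extendByZero_initialWord {b : ℕ} [NeZero b] (n j k : ℕ) (d : ℕ → Fin b) :
    windowFreq n j k (extendByZero (initialWord (n + k) d)) = windowFreq n j k d := by
  unfold windowFreq windowCount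
  congr! 8 with w _ p hp
  rw [Finset.mem_range] at hp
  exact digitWindow_congr fun x _ hx => extendByZero_of_lt _ (by omega)

/-- The mean square deviations are summable in `k`, so the sum of the squared deviations is almost
surely finite and its terms tend to zero. The index is shifted by one since the moment bound needs
`0 < k`. -/
theorem ae_tendsto_poissonZ {b : ℕ} (hb : 2 ≤ b) [NeZero b] {r : ℝ} (hr : 0 < r) (j : ℕ) :
    ∀ᵐ d ∂(uniformDigits b), Tendsto (fun k => poissonZ r j k d) atTop (𝓝 (poissonMass r j)) := by
  obtain ⟨K, hK, hsq⟩ := exists_sum_sq_windowFreq_sub_le hb hr j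
  set p := poissonMass r j
  have hb1 : (1 : ℝ) < b := by exact_mod_cast hb
  have hb0 : (0 : ℝ) < b := by linarith
  set N : ℕ → ℕ := fun k => ⌊r * (b : ℝ) ^ k⌋₊ + 1 with hN
  set F : (k : ℕ) → (Fin (N k + k) → Fin b) → ENNReal :=
    fun k u => ENNReal.ofReal ((windowFreq (N k) j k (extendByZero u) - p) ^ 2) with hF
  have hFd : ∀ k d, F k (initialWord (N k + k) d) = ENNReal.ofReal ((poissonZ r j k d - p) ^ 2) := by
    intro k d
    simp only [hF]
    rw [windowFreq_extendByZero_initialWord, poissonZ_eq_windowFreq hr.le]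
  have hFm : ∀ k, Measurable (F k) := fun k => measurable_of_countable _
  have hint : ∀ k, 0 < k → ∫⁻ d, F k (initialWord (N k + k) d) ∂(uniformDigits b) ≤
      ENNReal.ofReal (K * (k ^ 2 / (b : ℝ) ^ k)) := by
    intro k hk
    rw [← lintegral_map (hFm k) (measurable_initialWord _), lintegral_fintype]
    simp only [uniformDigits_map_initialWord_singleton, hF]
    rw [← Finset.sum_mul, ← ENNReal.ofReal_sum_of_nonneg (fun _ _ => sq_nonneg _),
      ← ENNReal.ofReal_mul (Finset.sum_nonneg fun _ _ => sq_nonneg _)]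
    refine ENNReal.ofReal_le_ofReal ?_
    rw [← div_eq_mul_inv, div_le_iff₀ (by positivity)]
    exact hsq k hk
  have hsummable : Summable (fun k : ℕ => K * ((k : ℝ) ^ 2 / (b : ℝ) ^ k)) := by
    refine Summable.mul_left _ ?_
    have := summable_pow_mul_geometric_of_norm_lt_one 2 (r := (b : ℝ)⁻¹) (by
      rw [norm_inv, Real.norm_of_nonneg hb0.le]
      exact inv_lt_one_of_one_lt₀ hb1)
    refine this.congr fun k => ?_
    rw [inv_pow, div_eq_mul_inv]
  have hmeas : ∀ k, Measurable (fun d => F (k + 1) (initialWord (N (k + 1) + (k + 1)) d)) :=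
    fun k => (hFm _).comp (measurable_initialWord _)
  have htsum : ∫⁻ d, ∑' k, F (k + 1) (initialWord (N (k + 1) + (k + 1)) d) ∂(uniformDigits b) ≠ ⊤ := by
    rw [lintegral_tsum fun k => (hmeas k).aemeasurable]
    refine ne_top_of_le_ne_top ?_ (ENNReal.tsum_le_tsum fun k => hint (k + 1) (Nat.succ_pos k))
    rw [← ENNReal.ofReal_tsum_of_nonneg (fun k => by positivity)
      ((summable_nat_add_iff 1).2 hsummable)]
    exact ENNReal.ofReal_ne_top
  have hae := ae_lt_top (Measurable.tsum hmeas) htsum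
  filter_upwards [hae] with d hd
  have h1 := ENNReal.tendsto_atTop_zero_of_tsum_ne_top hd.ne
  simp only [hFd] at h1
  have h2 : Tendsto (fun k => (poissonZ r j (k + 1) d - p) ^ 2) atTop (𝓝 0) := by
    have := (ENNReal.tendsto_toReal ENNReal.zero_ne_top).comp h1
    simpa [Function.comp_def, ENNReal.toReal_ofReal, sq_nonneg] using this
  have h3 : Tendsto (fun k => poissonZ r j (k + 1) d - p) atTop (𝓝 0) := by
    rw [tendsto_zero_iff_abs_tendsto_zero]
    have := (Real.continuous_sqrt.tendsto 0).comp h2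
    simpa [Function.comp_def, Real.sqrt_sq_eq_abs] using this
  rw [← tendsto_add_atTop_iff_nat 1]
  simpa using h3.add_const p

/-- Poisson generic sequences exist: almost every sequence of digits is one. -/
theorem exists_isPoissonGenericSeq {b : ℕ} (hb : 2 ≤ b) : ∃ d : ℕ → Fin b, IsPoissonGenericSeq d := by
  have : NeZero b := ⟨by omega⟩
  have h : ∀ᵐ d ∂(uniformDigits b), ∀ q : {q : ℚ // 0 < q}, ∀ j : ℕ,
      Tendsto (fun k => poissonZ ((q : ℚ) : ℝ) j k d) atTop (𝓝 (poissonMass ((q : ℚ) : ℝ) j)) := by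
    rw [ae_all_iff]
    intro q
    rw [ae_all_iff]
    intro j
    exact ae_tendsto_poissonZ hb (by exact_mod_cast q.2) j
  obtain ⟨d, hd⟩ := h.exists
  exact ⟨d, isPoissonGenericSeq_of_rat hb fun q hq j => hd ⟨q, hq⟩ j⟩

end Measure

-- Uniqueness of expansions

section Expansions

variable {b : ℕ}

theorem val_eq_zero_of_ofDigits_eq_zero {d : ℕ → Fin b} (h : Real.ofDigits d = 0) (n : ℕ) :
    (d n : ℕ) = 0 := by
  have h1 : Real.ofDigitsTerm d n ≤ Real.ofDigits d :=
    Real.summable_ofDigitsTerm.le_tsum n fun _ _ => Real.ofDigitsTerm_nonneg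
  have h2 : Real.ofDigitsTerm d n = 0 := le_antisymm (h ▸ h1) Real.ofDigitsTerm_nonneg
  have hb : (0 : ℝ) < b := by exact_mod_cast Fin.pos (d 0)
  have h3 : ((b : ℝ) ^ (n + 1))⁻¹ ≠ 0 := by positivity
  have h4 := (mul_eq_zero.1 h2).resolve_right h3
  exact_mod_cast h4

/-- The sequence of complementary digits has value `1 - 1 = 0`, so it is zero throughout. -/
theorem val_eq_of_ofDigits_eq_one (hb : 2 ≤ b) {d : ℕ → Fin b} (h : Real.ofDigits d = 1) (n : ℕ) :
    (d n : ℕ) = b - 1 := by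
  have h1 : Real.ofDigits d + Real.ofDigits (fun n => (d n).rev) = 1 := by
    rw [← Real.ofDigits_const_last_eq_one' (b := b) (by omega)]
    unfold Real.ofDigits
    rw [← Real.summable_ofDigitsTerm.tsum_add Real.summable_ofDigitsTerm]
    refine tsum_congr fun i => ?_
    unfold Real.ofDigitsTerm
    rw [← add_mul]
    congr 1
    rw [Fin.val_rev]
    have := (d i).2
    norm_cast
    change (d i : ℕ) + (b - ((d i : ℕ) + 1)) = b - 1
    omega
  have h2 := val_eq_zero_of_ofDigits_eq_zero (d := fun n => (d n).rev) (by linarith) n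
  rw [Fin.val_rev] at h2
  have := (d n).2
  omega

theorem mul_ofDigits_eq (hb : 2 ≤ b) (d : ℕ → Fin b) :
    (b : ℝ) * Real.ofDigits d = (d 0 : ℕ) + Real.ofDigits (fun i => d (i + 1)) := by
  have hb0 : (b : ℝ) ≠ 0 := by positivity
  rw [Real.ofDigits_eq_sum_add_ofDigits d 1]
  simp only [Finset.sum_range_one, Real.ofDigitsTerm, zero_add, pow_one]
  field_simp

theorem exists_int_pow_mul_ofDigits_eq (hb : 2 ≤ b) (n : ℕ) (d : ℕ → Fin b) :
    ∃ z : ℤ, (b : ℝ) ^ n * Real.ofDigits d = z + Real.ofDigits (fun i => d (i + n)) := by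
  induction n with
  | zero => exact ⟨0, by simp⟩
  | succ n ih =>
    obtain ⟨z, hz⟩ := ih
    refine ⟨b * z + (d n : ℕ), ?_⟩
    have := mul_ofDigits_eq hb (fun i => d (i + n))
    rw [pow_succ', mul_assoc, hz, mul_add, this]
    simp only [zero_add]
    push_cast
    have h1 : ∀ i, i + 1 + n = i + (n + 1) := fun i => by ring
    simp only [h1]
    ring

/-- If a number has two different expansions, then one of them ends with zeros. -/
theorem eventually_zero_of_ofDigits_eq (hb : 2 ≤ b) {d e : ℕ → Fin b}
    (h : Real.ofDigits d = Real.ofDigits e) (hne : d ≠ e) :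
    (∀ᶠ x in atTop, (d x : ℕ) = 0) ∨ ∀ᶠ x in atTop, (e x : ℕ) = 0 := by
  have hex : ∃ n, d n ≠ e n := by
    by_contra hcon
    push Not at hcon
    exact hne (funext hcon)
  classical
  set n := Nat.find hex
  have hn : d n ≠ e n := Nat.find_spec hex
  have hlt : ∀ i < n, d i = e i := fun i hi => not_not.1 (Nat.find_min hex hi)
  have hb0 : (0 : ℝ) < b := by positivity
  have h1 : Real.ofDigits (fun i => d (i + n)) = Real.ofDigits (fun i => e (i + n)) := by
    rw [Real.ofDigits_eq_sum_add_ofDigits d n, Real.ofDigits_eq_sum_add_ofDigits e n] at h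
    have hs : ∑ i ∈ Finset.range n, Real.ofDigitsTerm d i =
        ∑ i ∈ Finset.range n, Real.ofDigitsTerm e i :=
      Finset.sum_congr rfl fun i hi => by
        simp only [Real.ofDigitsTerm, hlt i (Finset.mem_range.1 hi)]
    rw [hs] at h
    exact mul_left_cancel₀ (by positivity) (add_left_cancel h)
  have h2 := mul_ofDigits_eq hb (fun i => d (i + n))
  rw [h1, mul_ofDigits_eq hb (fun i => e (i + n))] at h2
  simp only [zero_add] at h2
  have hev : ∀ f : ℕ → Fin b, Real.ofDigits (fun i => f (i + 1 + n)) = 0 →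
      ∀ᶠ x in atTop, (f x : ℕ) = 0 := by
    intro f hf
    filter_upwards [eventually_ge_atTop (n + 1)] with x hx
    have := val_eq_zero_of_ofDigits_eq_zero hf (x - (n + 1))
    rwa [show x - (n + 1) + 1 + n = x by omega] at this
  have hd0 := Real.ofDigits_nonneg (fun i => d (i + 1 + n))
  have hd1 := Real.ofDigits_le_one (fun i => d (i + 1 + n))
  have he0 := Real.ofDigits_nonneg (fun i => e (i + 1 + n))
  have he1 := Real.ofDigits_le_one (fun i => e (i + 1 + n))
  have hn' : (d n : ℕ) ≠ e n := fun h => hn (Fin.ext h)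
  -- At the first disagreement the digits differ by at least one while both tails lie in `[0, 1]`,
  -- so the sequence with the larger digit has tail zero.
  rcases Nat.lt_or_gt_of_ne hn' with hlt' | hlt'
  · right
    refine hev e ?_
    have : ((d n : ℕ) : ℝ) + 1 ≤ (e n : ℕ) := by exact_mod_cast hlt'
    linarith
  · left
    refine hev d ?_
    have : ((e n : ℕ) : ℝ) + 1 ≤ (d n : ℕ) := by exact_mod_cast hlt'
    linarith

theorem isBaseExpansion_unique (hb : 2 ≤ b) {x : ℝ} {d e : ℕ → Fin b} (hd : IsBaseExpansion x d)
    (he : IsBaseExpansion x e) : d = e := by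
  by_contra hne
  rcases eventually_zero_of_ofDigits_eq hb (hd.1.trans he.1.symm) hne with h | h
  · exact hd.2 (h.mono fun _ h => not_not.2 h)
  · exact he.2 (h.mono fun _ h => not_not.2 h)

theorem exists_pow_mul_eq_of_eventually_zero (hb : 2 ≤ b) {d : ℕ → Fin b}
    (h : ∀ᶠ x in atTop, (d x : ℕ) = 0) : ∃ (n : ℕ) (z : ℤ), (b : ℝ) ^ n * Real.ofDigits d = z := by
  obtain ⟨n, hn⟩ := eventually_atTop.1 h
  obtain ⟨z, hz⟩ := exists_int_pow_mul_ofDigits_eq hb n d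
  refine ⟨n, z, ?_⟩
  rw [hz]
  have : Real.ofDigits (fun i => d (i + n)) = 0 := by
    unfold Real.ofDigits Real.ofDigitsTerm
    simp [hn]
  rw [this, add_zero]

/-- Otherwise the tail from position `n` would have an integer value, `0` or `1`, and its digits
would be constant. Thus removing the numbers `z / b ^ n` loses no generic number. -/
theorem pow_mul_ofDigits_ne_of_isPoissonGenericSeq (hb : 2 ≤ b) {d : ℕ → Fin b}
    (hd : IsPoissonGenericSeq d) (n : ℕ) (z : ℤ) : (b : ℝ) ^ n * Real.ofDigits d ≠ z := by
  intro h
  obtain ⟨w, hw⟩ := exists_int_pow_mul_ofDigits_eq hb n d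
  set t := Real.ofDigits (fun i => d (i + n)) with ht
  have h0 : 0 ≤ t := Real.ofDigits_nonneg _
  have h1 : t ≤ 1 := Real.ofDigits_le_one _
  have h2 : t = ((z - w : ℤ) : ℝ) := by push_cast; linarith
  have hconst : ∃ a : ℕ, ∀ i, (d (i + n) : ℕ) = a := by
    have h3 : (0 : ℤ) ≤ z - w := by exact_mod_cast h2 ▸ h0
    have h4 : z - w ≤ (1 : ℤ) := by exact_mod_cast h2 ▸ h1
    rcases (show z - w = 0 ∨ z - w = 1 by omega) with h5 | h5
    · rw [h5] at h2
      exact ⟨0, fun i => val_eq_zero_of_ofDigits_eq_zero (by rw [← ht, h2]; simp) i⟩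
    · rw [h5] at h2
      exact ⟨b - 1, fun i => val_eq_of_ofDigits_eq_one hb (by rw [← ht, h2]; simp) i⟩
  obtain ⟨a, ha⟩ := hconst
  refine not_isPoissonGenericSeq_of_eventually_const hb (d n) ?_ hd
  filter_upwards [eventually_ge_atTop n] with x hx
  have e1 := ha (x - n)
  have e2 := ha 0
  rw [Nat.sub_add_cancel hx] at e1
  rw [zero_add] at e2
  exact Fin.ext (e1.trans e2.symm)

end Expansions

-- The upper bound

section Borel

theorem isBoldSigma_two_iUnion {X ι : Type*} [TopologicalSpace X] [Countable ι] [Nonempty ι]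
    {F : ι → Set X} (h : ∀ i, IsClosed (F i)) : IsBoldSigma 2 (⋃ i, F i) := by
  obtain ⟨f, hf⟩ := exists_surjective_nat ι
  rw [IsBoldSigma]
  refine ⟨fun n => F (f n), fun n => ?_, (hf.iUnion_comp F).symm⟩
  rw [IsBoldPi]
  exact h _

theorem isBoldPi_three_iInter {X ι : Type*} [TopologicalSpace X] [Countable ι] [Nonempty ι]
    {F : ι → Set X} (h : ∀ i, IsBoldSigma 2 (F i)) : IsBoldPi 3 (⋂ i, F i) := by
  obtain ⟨f, hf⟩ := exists_surjective_nat ι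
  rw [IsBoldPi]
  exact ⟨fun n => F (f n), fun n => h _, (hf.iInter_comp F).symm⟩

theorem IsBoldSigma.exists_iUnion_closed {X : Type*} [TopologicalSpace X] {s : Set X}
    (h : IsBoldSigma 2 s) : ∃ F : ℕ → Set X, (∀ i, IsClosed (F i)) ∧ s = ⋃ i, F i := by
  rw [IsBoldSigma] at h
  obtain ⟨F, hF, rfl⟩ := h
  refine ⟨F, fun i => ?_, rfl⟩
  have := hF i
  rwa [IsBoldPi] at this

theorem IsBoldPi.exists_iInter_sigma_two {X : Type*} [TopologicalSpace X] {s : Set X}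
    (h : IsBoldPi 3 s) : ∃ F : ℕ → Set X, (∀ i, IsBoldSigma 2 (F i)) ∧ s = ⋂ i, F i := by
  rwa [IsBoldPi] at h

theorem IsBoldPi.preimage_three {X Y : Type*} [TopologicalSpace X] [TopologicalSpace Y] {f : X → Y}
    (hf : Continuous f) {s : Set Y} (h : IsBoldPi 3 s) : IsBoldPi 3 (f ⁻¹' s) := by
  obtain ⟨A, hA, rfl⟩ := h.exists_iInter_sigma_two
  rw [preimage_iInter]
  refine isBoldPi_three_iInter fun i => ?_
  obtain ⟨F, hF, hAF⟩ := (hA i).exists_iUnion_closed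
  rw [hAF, preimage_iUnion]
  exact isBoldSigma_two_iUnion fun j => (hF j).preimage hf

theorem isBoldSigma_two_compl_singleton (c : ℝ) : IsBoldSigma 2 {c}ᶜ := by
  have : ({c}ᶜ : Set ℝ) = ⋃ n : ℕ, {x | 1 / ((n : ℝ) + 1) ≤ |x - c|} := by
    ext x
    simp only [mem_compl_iff, mem_singleton_iff, mem_iUnion, mem_ofPred_eq]
    constructor
    · intro h
      obtain ⟨n, hn⟩ := exists_nat_one_div_lt (abs_pos.2 (sub_ne_zero.2 h))
      exact ⟨n, hn.le⟩
    · rintro ⟨n, hn⟩ rfl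
      rw [sub_self, abs_zero] at hn
      have : 0 < 1 / ((n : ℝ) + 1) := by positivity
      linarith
  rw [this]
  exact isBoldSigma_two_iUnion fun n => isClosed_le continuous_const (by fun_prop)

theorem continuous_windowFreq {b : ℕ} (hb : 2 ≤ b) (n j k : ℕ) :
    Continuous (windowFreq (b := b) n j k) := by
  have : NeZero b := ⟨by omega⟩
  have h : windowFreq (b := b) n j k =
      (fun u => windowFreq n j k (extendByZero u)) ∘ initialWord (n + k) := by
    funext d
    exact (windowFreq_extendByZero_initialWord n j k d).symm
  rw [h]
  refine Continuous.comp continuous_of_discreteTopology ?_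
  unfold initialWord
  fun_prop

/-- The sequences `d` for which `poissonZ q j k d` is within `1 / (N + 1)` of its expected limit
for every `k ≥ K`. -/
def poissonCloseSeqs (b : ℕ) (q : ℚ) (j N K : ℕ) : Set (ℕ → Fin b) :=
  {d | ∀ k ≥ K, |poissonZ (q : ℝ) j k d - poissonMass q j| ≤ 1 / ((N : ℝ) + 1)}

theorem isClosed_poissonCloseSeqs {b : ℕ} (hb : 2 ≤ b) {q : ℚ} (hq : 0 < q) (j N K : ℕ) :
    IsClosed (poissonCloseSeqs b q j N K) := by
  have h : poissonCloseSeqs b q j N K =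
      ⋂ k ≥ K, {d | |poissonZ (q : ℝ) j k d - poissonMass q j| ≤ 1 / ((N : ℝ) + 1)} := by
    ext d
    simp [poissonCloseSeqs]
  rw [h]
  refine isClosed_biInter fun k _ => isClosed_le ?_ continuous_const
  have hq' : (0 : ℝ) ≤ q := by exact_mod_cast hq.le
  simp only [poissonZ_eq_windowFreq hq']
  exact ((continuous_windowFreq hb _ _ _).sub continuous_const).abs

theorem isPoissonGenericSeq_iff_poissonCloseSeqs {b : ℕ} (hb : 2 ≤ b) (d : ℕ → Fin b) :
    IsPoissonGenericSeq d ↔ ∀ q : ℚ, 0 < q → ∀ j N : ℕ, ∃ K, d ∈ poissonCloseSeqs b q j N K := by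
  constructor
  · intro h q hq j N
    have h1 : Tendsto (fun k => poissonZ (q : ℝ) j k d) atTop (𝓝 (poissonMass q j)) :=
      h q (by exact_mod_cast hq) j
    obtain ⟨K, hK⟩ := Metric.tendsto_atTop.1 h1 (1 / ((N : ℝ) + 1)) (by positivity)
    exact ⟨K, fun k hk => (hK k hk).le⟩
  · intro h
    refine isPoissonGenericSeq_of_rat hb fun q hq j => Metric.tendsto_atTop.2 fun ε hε => ?_
    obtain ⟨N, hN⟩ := exists_nat_one_div_lt hε
    obtain ⟨K, hK⟩ := h q hq j N
    exact ⟨K, fun k hk => (hK k hk).trans_lt hN⟩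

/-- Each condition `(q, j, N)` is allowed its own integer part and its own expansion, which makes it
a union of compact images. Outside the numbers `z / b ^ n` the expansion is unique, so all these
witnesses are the same sequence. -/
theorem poissonGenericReals_eq {b : ℕ} (hb : 2 ≤ b) :
    poissonGenericReals b = ⋂ i : (ℕ × ℤ) ⊕ ({q : ℚ // 0 < q} × ℕ × ℕ),
      Sum.elim (fun c => {(c.2 : ℝ) / (b : ℝ) ^ c.1}ᶜ)
        (fun c => ⋃ m : ℤ × ℕ,
          (fun d => (m.1 : ℝ) + Real.ofDigits d) '' poissonCloseSeqs b c.1 c.2.1 c.2.2 m.2) i := by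
  have hb0 : (0 : ℝ) < b := by positivity
  ext x
  simp only [mem_iInter, Sum.forall, Sum.elim_inl, Sum.elim_inr, Prod.forall, mem_compl_iff,
    mem_singleton_iff, mem_iUnion, Prod.exists, mem_image, Subtype.forall]
  have hfract : ∀ (n : ℕ) (z : ℤ), (b : ℝ) ^ n * Int.fract x = z →
      x = ((z + b ^ n * ⌊x⌋ : ℤ) : ℝ) / (b : ℝ) ^ n := by
    intro n z h
    rw [eq_div_iff (by positivity)]
    push_cast
    rw [← h]
    nth_rewrite 1 [← Int.floor_add_fract x]
    ring
  constructor
  · rintro ⟨d, hd, hgen⟩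
    refine ⟨fun n z hx => ?_, fun q hq j N => ?_⟩
    · refine pow_mul_ofDigits_ne_of_isPoissonGenericSeq hb hgen n (z - b ^ n * ⌊x⌋) ?_
      rw [hd.1, Int.fract]
      rw [eq_div_iff (by positivity)] at hx
      push_cast
      rw [← hx]
      ring
    · obtain ⟨K, hK⟩ := (isPoissonGenericSeq_iff_poissonCloseSeqs hb d).1 hgen q hq j N
      exact ⟨⌊x⌋, K, d, hK, by rw [hd.1, Int.floor_add_fract]⟩
  · rintro ⟨hC, hA⟩
    have hexp : ∀ (m : ℤ) (d : ℕ → Fin b), (m : ℝ) + Real.ofDigits d = x →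
        Real.ofDigits d = Int.fract x ∧ ∃ᶠ i in atTop, (d i : ℕ) ≠ 0 := by
      intro m d hmd
      have h0 := Real.ofDigits_nonneg d
      have h1 : Real.ofDigits d < 1 := by
        refine lt_of_le_of_ne (Real.ofDigits_le_one d) fun h => hC 0 (m + 1) ?_
        rw [← hmd, h]
        simp
      have hfr : Real.ofDigits d = Int.fract x := by
        rw [← hmd, Int.fract_intCast_add, Int.fract_eq_self.2 ⟨h0, h1⟩]
      refine ⟨hfr, fun hcon => ?_⟩
      obtain ⟨n, z, hz⟩ := exists_pow_mul_eq_of_eventually_zero hb (hcon.mono fun _ h => not_not.1 h)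
      exact hC n _ (hfract n z (hfr ▸ hz))
    -- Any one condition serves to produce an expansion of `x`.
    obtain ⟨m, _, d, _, hmd⟩ := hA 1 one_pos 0 0
    have hd := hexp m d hmd
    refine ⟨d, hd, (isPoissonGenericSeq_iff_poissonCloseSeqs hb d).2 fun q hq j N => ?_⟩
    obtain ⟨m', K, e, he, hme⟩ := hA q hq j N
    have : d = e := isBaseExpansion_unique hb hd (hexp m' e hme)
    exact ⟨K, this ▸ he⟩

theorem isBoldPi_three_poissonGenericReals {b : ℕ} (hb : 2 ≤ b) :
    IsBoldPi 3 (poissonGenericReals b) := by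
  rw [poissonGenericReals_eq hb]
  refine isBoldPi_three_iInter ?_
  rintro (c | ⟨⟨q, hq⟩, j, N⟩)
  · exact isBoldSigma_two_compl_singleton _
  · refine isBoldSigma_two_iUnion fun m => ?_
    have hc : Continuous (fun d : ℕ → Fin b => (m.1 : ℝ) + Real.ofDigits d) :=
      continuous_const.add Real.continuous_ofDigits
    exact ((isClosed_poissonCloseSeqs hb hq j N m.2).isCompact.image hc).isClosed

end Borel

-- A normal form for `Π⁰₃` sets in zero-dimensional spaces

section ZeroDimensional

variable {X : Type*}

open Classical in
/-- The index of the closed set that is being tested at stage `m`: it moves on when the clopen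
approximation of the current closed set excludes `x`. -/
noncomputable def testIndex (C : ℕ → ℕ → Set X) : ℕ → X → ℕ
  | 0, _ => 0
  | m + 1, x => if x ∈ C (testIndex C m x) m then testIndex C m x else testIndex C m x + 1

open Classical in
theorem testIndex_succ (C : ℕ → ℕ → Set X) (m : ℕ) : testIndex C (m + 1) =
    fun x => if x ∈ C (testIndex C m x) m then testIndex C m x else testIndex C m x + 1 := by
  funext x
  rw [testIndex]

variable [TopologicalSpace X]

theorem exists_antitone_clopen_iInter_eq [SecondCountableTopology X]
    (hX : TopologicalSpace.IsTopologicalBasis {U : Set X | IsClopen U}) {F : Set X}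
    (hF : IsClosed F) :
    ∃ C : ℕ → Set X, (∀ m, IsClopen (C m)) ∧ Antitone C ∧ F = ⋂ m, C m := by
  obtain ⟨S, hS, hFS⟩ := hX.open_eq_sUnion hF.isOpen_compl
  obtain ⟨T, hTc, hTS, hT⟩ := TopologicalSpace.isOpen_sUnion_countable S fun s hs => (hS hs).isOpen
  -- Inserting `∅` allows an enumeration by `ℕ` even if `T` is empty.
  obtain ⟨U, hU⟩ := (hTc.insert ∅).exists_eq_range (insert_nonempty _ _)
  have hUc : ∀ i, IsClopen (U i) := by
    intro i
    have : U i ∈ insert ∅ T := hU ▸ mem_range_self i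
    rcases this with h | h
    · rw [h]
      exact isClopen_empty
    · exact hS (hTS h)
  have hUF : ⋃ i, U i = Fᶜ := by
    rw [← sUnion_range, ← hU, sUnion_insert, empty_union, hT, hFS]
  refine ⟨fun m => ⋂ i ∈ Finset.range (m + 1), (U i)ᶜ, fun m => ?_, fun m m' hm => ?_, ?_⟩
  · exact isClopen_biInter_finset fun i _ => (hUc i).compl
  · exact biInter_subset_biInter_left fun i hi => by
      simp only [Finset.coe_range, mem_Iio] at hi ⊢
      omega
  · rw [← compl_compl F, ← hUF]
    ext x
    simp only [mem_compl_iff, mem_iUnion, not_exists, mem_iInter, Finset.mem_range]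
    exact ⟨fun h m i _ => h i, fun h i => h i i (Nat.lt_succ_self i)⟩

theorem isClopen_mem_family {s : X → ℕ} (hs : Continuous s) {C : ℕ → Set X}
    (hC : ∀ i, IsClopen (C i)) : IsClopen {x | x ∈ C (s x)} := by
  have key : ∀ D : ℕ → Set X, (∀ i, IsOpen (D i)) → IsOpen {x | x ∈ D (s x)} := by
    intro D hD
    have : {x | x ∈ D (s x)} = ⋃ i, s ⁻¹' {i} ∩ D i := by
      ext x
      simp
    rw [this]
    exact isOpen_iUnion fun i => ((isOpen_discrete {i}).preimage hs).inter (hD i)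
  exact ⟨⟨key (fun i => (C i)ᶜ) fun i => (hC i).compl.isOpen⟩, key C fun i => (hC i).isOpen⟩

theorem continuous_testIndex {C : ℕ → ℕ → Set X} (hC : ∀ i m, IsClopen (C i m)) (m : ℕ) :
    Continuous (testIndex C m) := by
  classical
  induction m with
  | zero => exact continuous_const
  | succ m ih =>
    have h := isClopen_mem_family ih fun i => hC i m
    rw [testIndex_succ]
    refine continuous_if (fun a ha => ?_) ih.continuousOn (by fun_prop)
    rw [h.frontier_eq] at ha
    exact absurd ha (notMem_empty a)

/-- In a zero-dimensional second countable space, a `Σ⁰₂` set consists of the points which belong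
to finitely many members of some sequence of clopen sets. -/
theorem IsBoldSigma.exists_clopen_eventually_notMem [SecondCountableTopology X]
    (hX : TopologicalSpace.IsTopologicalBasis {U : Set X | IsClopen U}) {A : Set X}
    (hA : IsBoldSigma 2 A) :
    ∃ E : ℕ → Set X, (∀ m, IsClopen (E m)) ∧ ∀ x, x ∈ A ↔ ∀ᶠ m in atTop, x ∉ E m := by
  classical
  obtain ⟨F, hF, rfl⟩ := hA.exists_iUnion_closed
  choose C hCc hCa hCF using fun i => exists_antitone_clopen_iInter_eq hX (hF i)
  set s := testIndex C with hs
  have hsucc : ∀ m x, s (m + 1) x = if x ∈ C (s m x) m then s m x else s m x + 1 :=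
    fun m x => congrFun (testIndex_succ C m) x
  -- The set `E m` consists of the points whose index moves at stage `m`.
  refine ⟨fun m => {x | x ∈ C (s m x) m}ᶜ, fun m =>
    (isClopen_mem_family (continuous_testIndex hCc m) fun i => hCc i m).compl, fun x => ?_⟩
  simp only [mem_iUnion, mem_compl_iff, mem_ofPred_eq, not_not]
  have hmono : Monotone fun m => s m x := by
    refine monotone_nat_of_le_succ fun m => ?_
    rw [hsucc]
    split_ifs <;> omega
  constructor
  · rintro ⟨i, hi⟩
    -- The approximations of a closed set containing `x` never exclude `x`, so the index cannot move
    -- past `i`; being monotone and bounded, it stabilizes.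
    have hbound : ∀ m, s m x ≤ i := by
      intro m
      induction m with
      | zero => simp [hs, testIndex]
      | succ m ih =>
        rw [hsucc]
        split_ifs with h
        · exact ih
        · have : s m x ≠ i := by
            rintro rfl
            rw [hCF] at hi
            exact h (mem_iInter.1 hi m)
          omega
    obtain ⟨n, hn⟩ := eventually_atTop.1 (tendsto_atTop_ciSup hmono
      ⟨i, by rintro _ ⟨m, rfl⟩; exact hbound m⟩ |>.eventually_mem
        ((isOpen_discrete {⨆ m, s m x}).mem_nhds rfl))
    filter_upwards [eventually_ge_atTop n] with m hm
    by_contra hcon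
    have h1 := hn m hm
    have h2 := hn (m + 1) (by omega)
    simp only [mem_singleton_iff] at h1 h2
    rw [← h1, hsucc, if_neg hcon] at h2
    omega
  · intro h
    obtain ⟨n, hn⟩ := eventually_atTop.1 h
    have hconst : ∀ m ≥ n, s m x = s n x := by
      intro m hm
      induction m, hm using Nat.le_induction with
      | base => rfl
      | succ m hm ih => rw [hsucc, if_pos (hn m hm), ih]
    refine ⟨s n x, ?_⟩
    rw [hCF]
    refine mem_iInter.2 fun m => ?_
    have h1 := hn (max m n) (le_max_right _ _)
    rw [hconst _ (le_max_right _ _)] at h1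
    exact hCa _ (le_max_left m n) h1

/-- In a zero-dimensional second countable space, every `Π⁰₃` set is the preimage, under a
continuous map to the Baire space, of the set of sequences that tend to infinity. -/
theorem IsBoldPi.exists_tendsto_atTop_iff [SecondCountableTopology X]
    (hX : TopologicalSpace.IsTopologicalBasis {U : Set X | IsClopen U}) {B : Set X}
    (hB : IsBoldPi 3 B) :
    ∃ z : ℕ → X → ℕ, (∀ m, Continuous (z m)) ∧ (∀ m x, z m x ≤ m) ∧
      ∀ x, x ∈ B ↔ Tendsto (fun m => z m x) atTop atTop := by
  classical
  obtain ⟨A, hA, rfl⟩ := hB.exists_iInter_sigma_two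
  choose E hE hEA using fun n => (hA n).exists_clopen_eventually_notMem hX
  -- The least `n ≤ m` with `x ∈ E n m`, and `m` if there is none. It tends to infinity exactly when
  -- each `n` is hit only finitely often.
  set z : ℕ → X → ℕ := fun m x =>
    (Finset.range (m + 1)).inf' Finset.nonempty_range_add_one (fun n => if x ∈ E n m then n else m)
    with hz
  refine ⟨z, fun m => ?_, fun m x => ?_, fun x => ?_⟩
  · refine Continuous.finset_inf'_apply _ fun n _ => ?_
    refine continuous_if (fun a ha => ?_) continuousOn_const continuousOn_const
    have := (hE n m).frontier_eq
    rw [show {x | x ∈ E n m} = E n m from rfl, this] at ha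
    exact absurd ha (notMem_empty a)
  · refine (Finset.inf'_le _ (Finset.self_mem_range_succ m)).trans ?_
    split_ifs <;> exact le_rfl
  · rw [mem_iInter, tendsto_atTop]
    constructor
    · intro h K
      have h1 : ∀ᶠ m in atTop, ∀ n < K, x ∉ E n m := by
        have := (Finset.range K).eventually_all (l := atTop) (p := fun n m => x ∉ E n m)
        simp only [Finset.mem_range] at this
        exact this.2 fun n _ => (hEA n x).1 (h n)
      filter_upwards [h1, eventually_ge_atTop K] with m hm hmK
      refine Finset.le_inf' _ _ fun n _ => ?_
      split_ifs with hn
      · by_contra hlt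
        exact hm n (by omega) hn
      · exact hmK
    · intro h n
      rw [hEA]
      filter_upwards [h (n + 1), eventually_ge_atTop n] with m hm hmn hx
      have h1 : z m x ≤ if x ∈ E n m then n else m :=
        Finset.inf'_le (fun n => if x ∈ E n m then n else m)
          (Finset.mem_range.2 (show n < m + 1 by omega))
      rw [if_pos hx] at h1
      omega

end ZeroDimensional

-- Spoiling a generic sequence

section Spoiled

variable {b : ℕ}

/-- The summands are `o(b ^ m)`, hence their partial sums are negligible against those of `b ^ m`,
and a geometric sum is controlled by its next term. -/
theorem tendsto_sum_div_pow (hb : 2 ≤ b) {z : ℕ → ℕ} (hz : Tendsto z atTop atTop) :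
    Tendsto (fun K => ((∑ m ∈ Finset.range K, b ^ m / (z m + 2) : ℕ) : ℝ) / (b : ℝ) ^ K)
      atTop (𝓝 0) := by
  have hb1 : (1 : ℝ) < b := by exact_mod_cast hb
  have hb0 : (0 : ℝ) < b := by linarith
  have h1 : (fun m : ℕ => ((b ^ m / (z m + 2) : ℕ) : ℝ)) =o[atTop] fun m => (b : ℝ) ^ m := by
    rw [Asymptotics.isLittleO_iff_tendsto fun m h => absurd h (by positivity)]
    have h2 : Tendsto (fun m => ((z m : ℝ))⁻¹) atTop (𝓝 0) :=
      tendsto_inv_atTop_zero.comp (tendsto_natCast_atTop_atTop.comp hz)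
    refine squeeze_zero' (Eventually.of_forall fun m => by positivity) ?_ h2
    filter_upwards [hz.eventually_ge_atTop 1] with m hm
    have hzm : (0 : ℝ) < z m := by exact_mod_cast hm
    rw [div_le_iff₀ (by positivity), ← div_eq_inv_mul]
    calc ((b ^ m / (z m + 2) : ℕ) : ℝ) ≤ ((b ^ m : ℕ) : ℝ) / ((z m + 2 : ℕ) : ℝ) :=
          Nat.cast_div_le
      _ ≤ (b : ℝ) ^ m / z m := by
          push_cast
          gcongr
          linarith
  have h3 := h1.sum_range (fun m => by positivity) (by
    refine tendsto_atTop_mono (fun K => ?_) tendsto_natCast_atTop_atTop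
    calc (K : ℝ) = ∑ _m ∈ Finset.range K, (1 : ℝ) := by simp
      _ ≤ _ := Finset.sum_le_sum fun m _ => one_le_pow₀ hb1.le)
  have h4 : (fun K => ∑ m ∈ Finset.range K, (b : ℝ) ^ m) =O[atTop] fun K => (b : ℝ) ^ K := by
    refine Asymptotics.IsBigO.of_bound 1 (Eventually.of_forall fun K => ?_)
    rw [one_mul, Real.norm_of_nonneg (by positivity), Real.norm_of_nonneg (by positivity)]
    have : ∑ m ∈ Finset.range K, b ^ m ≤ b ^ K := (Nat.geomSum_lt hb (by simp)).le
    exact_mod_cast this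
  have h5 := (h3.trans_isBigO h4).tendsto_div_nhds_zero
  simpa using h5

variable [NeZero b]

/-- The sequence `e`, with its first digit replaced by `0` and, for each `m`, the last
`b ^ m / (z m + 2)` digits before position `b ^ m` replaced by `1`. -/
def spoiledSeq (e : ℕ → Fin b) (z : ℕ → ℕ) : ℕ → Fin b := fun p =>
  -- The leading zero keeps the value below `1`. The `+ 2` confines a block to the last half of the
  -- digits before `b ^ m`, hence to positions at least `b ^ (m - 1)` when `2 ≤ b`, so blocks are
  -- disjoint and `m` can be read off as `Nat.log b p + 1`.
  if p = 0 then 0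
  else if b ^ (Nat.log b p + 1) ≤ p + b ^ (Nat.log b p + 1) / (z (Nat.log b p + 1) + 2) then 1
  else e p

theorem spoiledSeq_eq_one (hb : 2 ≤ b) (e : ℕ → Fin b) (z : ℕ → ℕ) {m p : ℕ} (hm : 0 < m)
    (h1 : b ^ (m - 1) ≤ p) (h2 : p < b ^ m) (h3 : b ^ m ≤ p + b ^ m / (z m + 2)) :
    spoiledSeq e z p = 1 := by
  have hlog : Nat.log b p + 1 = m := by
    rw [Nat.log_eq_of_pow_le_of_lt_pow h1 (by rwa [Nat.sub_add_cancel hm])]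
    omega
  have hp : p ≠ 0 := by
    have : 0 < b ^ (m - 1) := by positivity
    omega
  unfold spoiledSeq
  rw [if_neg hp, hlog, if_pos h3]

/-- The bound `z m ≤ m` keeps the block before `b ^ m` nonempty once `m + 2 ≤ b ^ m`, so a digit `1`
stands at `b ^ m - 1`. -/
theorem frequently_spoiledSeq_ne_zero (hb : 2 ≤ b) (e : ℕ → Fin b) {z : ℕ → ℕ}
    (hz : ∀ m, z m ≤ m) : ∃ᶠ p in atTop, (spoiledSeq e z p : ℕ) ≠ 0 := by
  rw [frequently_atTop]
  intro N
  have h1 : N + 2 < b ^ (N + 2) := Nat.lt_pow_self (by omega)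
  have h2 : (N + 2) + 2 ≤ b ^ (N + 2) := by
    have h3 : N + 1 < b ^ (N + 1) := Nat.lt_pow_self (by omega)
    have h4 : 2 * b ^ (N + 1) ≤ b ^ (N + 2) := by
      rw [pow_succ' b (N + 1)]
      exact Nat.mul_le_mul_right _ hb
    omega
  refine ⟨b ^ (N + 2) - 1, by omega, ?_⟩
  rw [spoiledSeq_eq_one hb e z (m := N + 2) (by omega)]
  · rw [Fin.val_one', Nat.mod_eq_of_lt (by omega)]
    exact one_ne_zero
  · have : b ^ (N + 2 - 1) < b ^ (N + 2) := Nat.pow_lt_pow_right (by omega) (by omega)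
    omega
  · omega
  · have : 1 ≤ b ^ (N + 2) / (z (N + 2) + 2) := by
      rw [Nat.one_le_div_iff (by omega)]
      have := hz (N + 2)
      omega
    omega

theorem ofDigits_spoiledSeq_lt_one (hb : 2 ≤ b) (e : ℕ → Fin b) (z : ℕ → ℕ) :
    Real.ofDigits (spoiledSeq e z) < 1 := by
  refine lt_of_le_of_ne (Real.ofDigits_le_one _) fun h => ?_
  have := val_eq_of_ofDigits_eq_one hb h 0
  simp only [spoiledSeq, if_true, Fin.val_zero] at this
  omega

theorem continuous_spoiledSeq {X : Type*} [TopologicalSpace X] (e : ℕ → Fin b) {z : ℕ → X → ℕ}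
    (hz : ∀ m, Continuous (z m)) : Continuous (fun x => spoiledSeq e (fun m => z m x)) := by
  refine continuous_pi fun p => ?_
  have h : Continuous (fun t : ℕ => if p = 0 then (0 : Fin b)
    else if b ^ (Nat.log b p + 1) ≤ p + b ^ (Nat.log b p + 1) / (t + 2) then 1 else e p) :=
    continuous_of_discreteTopology
  exact h.comp (hz (Nat.log b p + 1))

/-- If `z k < c` for infinitely many `k`, then at those scales the digits between `(1 - 1 / (c + 2))
* b ^ k` and `b ^ k` are all `1`. -/
theorem not_isPoissonGenericSeq_spoiledSeq (hb : 2 ≤ b) (e : ℕ → Fin b) {z : ℕ → ℕ}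
    (hz : ¬ Tendsto z atTop atTop) : ¬ IsPoissonGenericSeq (spoiledSeq e z) := by
  rw [tendsto_atTop, not_forall] at hz
  obtain ⟨c, hc⟩ := hz
  have hc2 : (1 : ℝ) / (c + 2) ≤ 1 / 2 := by
    have : (0 : ℝ) ≤ c := by positivity
    gcongr
    linarith
  have hc0 : (0 : ℝ) < 1 / (c + 2) := by positivity
  refine not_isPoissonGenericSeq_of_frequently_const hb (r := 1 - 1 / ((c : ℝ) + 2)) (s := 1)
    (by linarith) (by linarith) 1 ?_
  have hc' : ∃ᶠ m in atTop, ¬ c ≤ z m := not_eventually.1 hc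
  refine (hc'.and_eventually (eventually_ge_atTop 1)).mono ?_
  rintro k ⟨hk, hk1⟩ x hx hx'
  have hbk : (0 : ℝ) < (b : ℝ) ^ k := by
    have := NeZero.pos b
    positivity
  have hfl : ⌊1 * (b : ℝ) ^ k⌋₊ = b ^ k := by
    rw [one_mul]
    exact_mod_cast Nat.floor_natCast (R := ℝ) (b ^ k)
  rw [hfl] at hx'
  have hxr := Nat.lt_of_floor_lt hx
  have h1 : ((b ^ k - x : ℕ) : ℝ) * (c + 2) < ((b ^ k : ℕ) : ℝ) := by
    rw [Nat.cast_sub hx'.le, ← lt_div_iff₀ (by positivity)]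
    push_cast
    calc (b : ℝ) ^ k - x < (b : ℝ) ^ k - (1 - 1 / ((c : ℝ) + 2)) * (b : ℝ) ^ k := by linarith
      _ = _ := by ring
  have h2 : (b ^ k - x) * (c + 2) < b ^ k := by exact_mod_cast h1
  refine spoiledSeq_eq_one hb e z hk1 ?_ hx' ?_
  · have h3 : 2 * b ^ (k - 1) ≤ b ^ k := by
      obtain ⟨l, rfl⟩ := Nat.exists_eq_add_of_le' hk1
      rw [Nat.add_sub_cancel, pow_succ' b l]
      exact Nat.mul_le_mul_right _ hb
    have h4 : (b ^ k - x) * 2 ≤ (b ^ k - x) * (c + 2) := Nat.mul_le_mul_left _ (by omega)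
    omega
  · have h3 : b ^ k - x ≤ b ^ k / (z k + 2) := by
      rw [Nat.le_div_iff_mul_le (by omega)]
      exact (Nat.mul_le_mul_left _ (by omega)).trans h2.le
    omega

/-- A changed window starts at `0` or meets a block, and a block of length `t` is met by at most `t
+ k` windows. -/
theorem card_digitWindow_spoiledSeq_ne_le (e : ℕ → Fin b) (z : ℕ → ℕ) {n k K : ℕ}
    (hK : n + k ≤ b ^ K) :
    ((Finset.range n).filter
      (fun p => digitWindow k (spoiledSeq e z) p ≠ digitWindow k e p)).card ≤
      1 + ((K + 1) * k + ∑ m ∈ Finset.range (K + 1), b ^ m / (z m + 2)) := by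
  have hsub : (Finset.range n).filter
      (fun p => digitWindow k (spoiledSeq e z) p ≠ digitWindow k e p) ⊆
      {0} ∪ (Finset.range (K + 1)).biUnion
        (fun m => Finset.Ico (b ^ m - b ^ m / (z m + 2) - k) (b ^ m)) := by
    intro p hp
    rw [Finset.mem_filter, Finset.mem_range] at hp
    obtain ⟨hpn, hne⟩ := hp
    rw [Finset.mem_union, Finset.mem_singleton, Finset.mem_biUnion]
    by_contra hcon
    push Not at hcon
    refine hne (digitWindow_congr fun x hx hx' => ?_)
    have hx0 : x ≠ 0 := by omega
    have hlog : Nat.log b x < K := Nat.log_lt_of_lt_pow hx0 (by omega)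
    unfold spoiledSeq
    rw [if_neg hx0, if_neg]
    intro hle
    have h1 := hcon.2 (Nat.log b x + 1) (Finset.mem_range.2 (by omega))
    rw [Finset.mem_Ico] at h1
    have h2 : x < b ^ (Nat.log b x + 1) := by
      rcases Nat.lt_or_ge 1 b with hb1 | hb1
      · exact Nat.lt_pow_succ_log_self hb1 x
      · have : b ^ K ≤ 1 := Nat.pow_le_one_iff (by omega) |>.2 hb1
        omega
    omega
  refine (Finset.card_le_card hsub).trans ((Finset.card_union_le _ _).trans ?_)
  rw [Finset.card_singleton]
  refine Nat.add_le_add_left (Finset.card_biUnion_le.trans ?_) 1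
  calc _ ≤ ∑ m ∈ Finset.range (K + 1), (k + b ^ m / (z m + 2)) := by
        refine Finset.sum_le_sum fun m _ => ?_
        rw [Nat.card_Ico]
        generalize b ^ m / (z m + 2) = t
        omega
    _ = _ := by simp [Finset.sum_add_distrib]

theorem isPoissonGenericSeq_spoiledSeq (hb : 2 ≤ b) {e : ℕ → Fin b} (he : IsPoissonGenericSeq e)
    {z : ℕ → ℕ} (hz : Tendsto z atTop atTop) : IsPoissonGenericSeq (spoiledSeq e z) := by
  intro r hr j
  have hb1 : (1 : ℝ) < b := by exact_mod_cast hb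
  have hb0 : (0 : ℝ) < b := by linarith
  -- With `r + 2 < b ^ c`, all windows of scale `k` lie before position `b ^ (c + k)`, so the blocks
  -- up to index `c + k` suffice.
  obtain ⟨c, hc⟩ := pow_unbounded_of_one_lt (r + 2) hb1
  have hbound : ∀ k, |poissonZ r j k (spoiledSeq e z) - poissonZ r j k e| ≤
      2 * ((1 + (((c + k + 1) * k : ℕ) : ℝ)) / (b : ℝ) ^ k +
        ((∑ m ∈ Finset.range (k + (c + 1)), b ^ m / (z m + 2) : ℕ) : ℝ) /
          (b : ℝ) ^ (k + (c + 1)) * (b : ℝ) ^ (c + 1)) := by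
    intro k
    rw [poissonZ_eq_windowFreq hr.le, poissonZ_eq_windowFreq hr.le]
    refine (abs_windowFreq_sub_le_of_seq _ _ _ _ _).trans ?_
    have hK : ⌊r * (b : ℝ) ^ k⌋₊ + 1 + k ≤ b ^ (c + k) := by
      have h1 := Nat.floor_le (a := r * (b : ℝ) ^ k) (by positivity)
      have h2 : ((k + 1 : ℕ) : ℝ) ≤ (b : ℝ) ^ k := by
        exact_mod_cast Nat.lt_pow_self (n := k) (show 1 < b by omega)
      have h3 : (r + 2) * (b : ℝ) ^ k ≤ (b : ℝ) ^ c * (b : ℝ) ^ k := by gcongr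
      have h4 : ((⌊r * (b : ℝ) ^ k⌋₊ + 1 + k : ℕ) : ℝ) ≤ ((b ^ (c + k) : ℕ) : ℝ) := by
        push_cast at h2 ⊢
        rw [pow_add]
        nlinarith
      exact_mod_cast h4
    have h5 := card_digitWindow_spoiledSeq_ne_le e z hK
    have h6 : (((Finset.range (⌊r * (b : ℝ) ^ k⌋₊ + 1)).filter
        (fun p => digitWindow k (spoiledSeq e z) p ≠ digitWindow k e p)).card : ℝ) ≤
        1 + ((((c + k + 1) * k : ℕ) : ℝ) +
          ((∑ m ∈ Finset.range (c + k + 1), b ^ m / (z m + 2) : ℕ) : ℝ)) := by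
      refine (Nat.cast_le.2 h5).trans (le_of_eq ?_)
      rw [Nat.cast_add, Nat.cast_add, Nat.cast_one]
    rw [show k + (c + 1) = c + k + 1 by ring]
    calc _ ≤ 2 * (1 + ((((c + k + 1) * k : ℕ) : ℝ) +
          ((∑ m ∈ Finset.range (c + k + 1), b ^ m / (z m + 2) : ℕ) : ℝ))) / (b : ℝ) ^ k := by
          gcongr
      _ = _ := by
          rw [show (b : ℝ) ^ (c + k + 1) = (b : ℝ) ^ (c + 1) * (b : ℝ) ^ k by ring]
          field_simp
          ring
  have hlim1 : Tendsto (fun k : ℕ => (1 + (((c + k + 1) * k : ℕ) : ℝ)) / (b : ℝ) ^ k)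
      atTop (𝓝 0) := by
    have e0 := tendsto_one_div_pow_natCast hb
    have e1 := (tendsto_pow_const_div_const_pow_of_one_lt 1 hb1).const_mul ((c : ℝ) + 1)
    have e2 := tendsto_pow_const_div_const_pow_of_one_lt 2 hb1
    have := (e0.add e1).add e2
    simp only [mul_zero, add_zero] at this
    refine this.congr fun k => ?_
    push_cast
    ring
  have hlim2 := ((tendsto_sum_div_pow hb hz).comp (tendsto_add_atTop_nat (c + 1))).mul_const
    ((b : ℝ) ^ (c + 1))
  have hlim := (hlim1.add hlim2).const_mul 2
  simp only [zero_mul, add_zero, mul_zero, Function.comp_apply] at hlim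
  have hdiff := squeeze_zero_norm
    (f := fun k => poissonZ r j k (spoiledSeq e z) - poissonZ r j k e) (fun k => hbound k) hlim
  have := hdiff.add (he r hr j)
  simpa using this

theorem ofDigits_spoiledSeq_mem_iff (hb : 2 ≤ b) {e : ℕ → Fin b} (he : IsPoissonGenericSeq e)
    {z : ℕ → ℕ} (hz : ∀ m, z m ≤ m) :
    Real.ofDigits (spoiledSeq e z) ∈ poissonGenericReals b ↔ Tendsto z atTop atTop := by
  have hexp : IsBaseExpansion (Int.fract (Real.ofDigits (spoiledSeq e z))) (spoiledSeq e z) :=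
    ⟨(Int.fract_eq_self.2 ⟨Real.ofDigits_nonneg _, ofDigits_spoiledSeq_lt_one hb e z⟩).symm,
      frequently_spoiledSeq_ne_zero hb e hz⟩
  constructor
  · rintro ⟨d, hd, hgen⟩
    by_contra hcon
    rw [isBaseExpansion_unique hb hd hexp] at hgen
    exact not_isPoissonGenericSeq_spoiledSeq hb e hcon hgen
  · intro h
    exact ⟨_, hexp, isPoissonGenericSeq_spoiledSeq hb he h⟩

end Spoiled

-- The reduction and the theorem

theorem exists_continuous_Ico_mem_poissonGenericReals_iff {b : ℕ} (hb : 2 ≤ b) {X : Type*}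
    [TopologicalSpace X] [SecondCountableTopology X]
    (hX : TopologicalSpace.IsTopologicalBasis {U : Set X | IsClopen U}) {B : Set X}
    (hB : IsBoldPi 3 B) :
    ∃ f : X → Set.Ico (0 : ℝ) 1, Continuous f ∧ ∀ x, x ∈ B ↔ (f x : ℝ) ∈ poissonGenericReals b := by
  have : NeZero b := ⟨by omega⟩
  obtain ⟨e, he⟩ := exists_isPoissonGenericSeq hb
  obtain ⟨z, hzc, hzm, hzB⟩ := hB.exists_tendsto_atTop_iff hX
  refine ⟨fun x => ⟨Real.ofDigits (spoiledSeq e fun m => z m x), Real.ofDigits_nonneg _,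
    ofDigits_spoiledSeq_lt_one hb e _⟩, ?_, fun x => ?_⟩
  · exact (Real.continuous_ofDigits.comp (continuous_spoiledSeq e hzc)).subtype_mk _
  · rw [hzB]
    exact (ofDigits_spoiledSeq_mem_iff hb he fun m => hzm m x).symm

theorem theorem1 (b : ℕ) (hb : 2 ≤ b) :
    IsBoldPiComplete 3 (poissonGenericReals b) ∧
    IsBoldPiComplete 3 {x : Set.Ico (0 : ℝ) 1 | (x : ℝ) ∈ poissonGenericReals b} := by
  have hPi := isBoldPi_three_poissonGenericReals hb
  refine ⟨⟨hPi, fun X _ _ hX B hB => ?_⟩, hPi.preimage_three continuous_subtype_val,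
    fun X _ _ hX B hB => exists_continuous_Ico_mem_poissonGenericReals_iff hb hX hB⟩
  obtain ⟨f, hf, hfB⟩ := exists_continuous_Ico_mem_poissonGenericReals_iff hb hX hB
  exact ⟨fun x => f x, continuous_subtype_val.comp hf, hfB⟩
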